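/- Let $A=\bigoplus_{n\in\mathbb Z}A^n$ be a $\mathbb Z$-graded vector space over a field of characteristic zero. **Partitions.** An ordered partition is $\pi=(i_1|\cdots|i_r)$ with $r\ge 1$ and $i_l\ge 0$; it is regular if all $i_l\ge 1$. Put $d(\pi)=i_1+\cdots+i_r-1$ and $\bar d(\pi)=r-1$. For $\pi'=(j_1|\cdots|j_s)$ say that $\tau$ occurs in $\pi*\pi'$ (from slot $l$) if $\tau$ is obtained from $\pi$ by replacing the slot $i_l$ by some $(j_1+u_1|\cdots|j_s+u_s)$ with $u_h\ge 0$, $u_1+\cdots+u_s=i_l-1$. **Partitioned maps.** A partitioned map $x(\pi)$ of type $\pi$ is an $(i_1+\cdots+i_r)$-linear map $A^{\otimes(i_1+\cdots+i_r)}\to A$. If it changes the total degree by $|x|$, put $\|x\|=d(\pi)+|x|$; for homogeneous $a\in A$ put $\|a\|=|a|-1$. Let $\tilde x(a_1,\dots,a_n)=(-1)^{(n-1)\|a_1\|+(n-2)\|a_2\|+\cdots+\|a_{n-1}\|}x(a_1,\dots,a_n)$. The composition $\{x(\pi)\}\{y(\pi')\}$ is the sum of its components of types $\tau$ occurring in $\pi*\pi'$.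 The component of type $\tau$ sends $(a^{(1)}|\cdots|a^{(t)})$ to the sum, over the slots $l$ of $\pi$ from which $\tau$ occurs and over all subdivisions of the words in the $s$ slots of $\tau$ that replace slot $l$ into consecutive pieces $b^{(h)},c^{(h)},d^{(h)}$ with $c^{(h)}$ of length $j_h$, of $$\pm\,x\bigl(a^{(1)}|\cdots|a^{(l-1)}\,|\,\beta,\;y(c^{(1)}|\cdots|c^{(s)}),\;\delta\,|\,a^{(l+s)}|\cdots|a^{(t)}\bigr),$$ summed over all shuffles $\beta$ of $b^{(1)},\dots,b^{(s)}$ and $\delta$ of $d^{(1)},\dots,d^{(s)}$; the sign is the product of $(-1)^{\|u\|\,\|v\|}$ over all pairs of symbols $u,v$ interchanged with respect to the order $x,y,a_1,a_2,\dots$. **$G_\infty$ algebras.** $(A,m)$ is a $G_\infty$ algebra if $m=\sum_\pi m(\pi)$ is a formal sum of partitioned maps, one for each ordered partition, with $|m(\pi)|\equiv d(\pi)+\bar d(\pi)+1\pmod 2$, such that $m(1|0)=m(0|1)=\mathrm{id}_A$ are the only nonzero $m(\pi)$ with $\pi$ not regular, and such that $\{\tilde m\}\{\tilde m\}=0$,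 i.e. for every regular $\tau$ the (finite) sum of all components of type $\tau$ of the compositions $\{\tilde m(\pi)\}\{\tilde m(\pi')\}$ is zero. Call $(A,m)$ a *reduced* $G_\infty$ algebra if instead this is only required for those regular $\tau$ with $m(\tau)\ne 0$. **$A_\infty$ and $L_\infty$ algebras.** An $A_\infty$ algebra is $A$ with $n$-linear maps $m_n$, $n\ge 1$, $|m_n|\equiv n\pmod 2$, such that for all $n\ge 1$ and homogeneous $a_1,\dots,a_n$ $$\sum_{i+j=n+1}\ \sum_{p=0}^{j-1}(-1)^{\|a_1\|+\cdots+\|a_p\|}\,\tilde m_j(a_1,\dots,a_p,\tilde m_i(a_{p+1},\dots,a_{p+i}),a_{p+i+1},\dots,a_n)=0 .$$ An $L_\infty$ algebra is $A$ with graded antisymmetric $n$-linear maps $l_n$, $n\ge 1$, $|l_n|\equiv n\pmod 2$, such that for all $n\ge 1$ and homogeneous $a_1,\dots,a_n$ $$\sum_{i=1}^n(-1)^i\sum_{\sigma}\chi(\sigma;a)\,l_{n+1-i}(l_i(a_{\sigma(1)},\dots,a_{\sigma(i)}),a_{\sigma(i+1)},\dots,a_{\sigma(n)})=0,$$ where $\sigma$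 runs over the permutations increasing on $\{1,\dots,i\}$ and on $\{i+1,\dots,n\}$, and $\chi(\sigma;a)$ is the signature of $\sigma$ times the Koszul sign for the degrees $|a_i|$. **Lemma.** Let $(A,m)$ be a $G_\infty$ algebra. Then the one-slot part $m_A=m(0)+m(1)+m(2)+\cdots$ satisfies $\{\tilde m_A\}\{\tilde m_A\}=0$ (the component of every type $\tau$, regular or not, vanishes). Therefore $(A,m_A)$ is an $A_\infty$ algebra (in particular $m(0)=0$), and $(A,l_A)$ is an $L_\infty$ algebra, where $l_A$ is the term-by-term graded antisymmetrization $$l_n(a_1,\dots,a_n)=\sum_{\sigma\in S_n}\chi(\sigma;a)\,m(n)(a_{\sigma(1)},\dots,a_{\sigma(n)}).$$ If $(A,m)$ is only a reduced $G_\infty$ algebra, then the same holds with the same convention: $m(0)=0$ and $l_0=0$, the maps $m(n)$ and $l_n$, $n\ge1$, have degrees $\equiv n\pmod 2$, all $l_n$ are graded antisymmetric, the part of type $\tau$ of $\{\tilde m_A\}\{\tilde m_A\}=0$ holds whenever $m_A(\tau)\neq 0$, and for every $n\ge 1$ with $m(n)\ne 0$ the $A_\infty$ relation of $(m(i))_{i\ge1}$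 and the $L_\infty$ relation of $(l_i)_{i\ge1}$ with $n$ arguments hold. -/

import Mathlib

/-! ### Ordered partitions and their product -/

/-- Ordered partitions `(i₁|⋯|i_r)`, `r ≥ 1`, with slots `i_l ≥ 0`. -/
abbrev OrderedPartition : Type := {π : List ℕ // π ≠ []}

namespace OrderedPartition

/-- The number of arguments `i₁ + ⋯ + i_r`. -/
abbrev arity (π : OrderedPartition) : ℕ := π.1.sum

/-- `d(π) = i₁ + ⋯ + i_r - 1`. -/
def d (π : OrderedPartition) : ℤ := (π.1.sum : ℤ) - 1

/-- `d̄(π) = r - 1`. -/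
def dBar (π : OrderedPartition) : ℤ := (π.1.length : ℤ) - 1

/-- All slots are positive. -/
def Regular (π : OrderedPartition) : Prop := ∀ i ∈ π.1, 1 ≤ i

/-- The one-slot partition `(n)`. -/
def single (n : ℕ) : OrderedPartition := ⟨[n], by simp⟩

/-- The partition `(i|j)`. -/
def pair (i j : ℕ) : OrderedPartition := ⟨[i, j], by simp⟩

/-- `ρ` occurs in `(i) ∗ (j₁|⋯|j_s)`, that is `ρ = (j₁+u₁|⋯|j_s+u_s)` with `u₁ + ⋯ + u_s = i - 1`
(there is no such `ρ` for `i = 0`). -/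
def OccursInSlot (i : ℕ) (π' ρ : List ℕ) : Prop :=
  ∃ u : List ℕ, u.length = π'.length ∧ u.sum + 1 = i ∧ ρ = List.zipWith (· + ·) π' u

/-- `τ` is obtained from `π` by replacing the slot number `l` (counted from `0`), say `i`, by a
partition occurring in `(i) ∗ π'`. -/
def OccursAt (π π' τ : OrderedPartition) (l : ℕ) : Prop :=
  l < π.1.length ∧ ∃ ρ : List ℕ, OccursInSlot (π.1.getD l 0) π'.1 ρ ∧
    τ.1 = π.1.take l ++ ρ ++ π.1.drop (l + 1)

/-- `τ → π ∗ π'`. -/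
def Occurs (π π' τ : OrderedPartition) : Prop := ∃ l, OccursAt π π' τ l

theorem OccursInSlot.length_eq {i : ℕ} {π' ρ : List ℕ} (h : OccursInSlot i π' ρ) :
    ρ.length = π'.length := by
  obtain ⟨u, hu, -, rfl⟩ := h
  simp [hu]

theorem OccursInSlot.sum_eq {i : ℕ} {π' ρ : List ℕ} (h : OccursInSlot i π' ρ) :
    ρ.sum + 1 = i + π'.sum := by
  obtain ⟨u, hu, hs, rfl⟩ := h
  have key : ∀ p u : List ℕ, u.length = p.length →
      (List.zipWith (· + ·) p u).sum = p.sum + u.sum := by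
    intro p
    induction p with
    | nil => intro u hu; simp [List.length_eq_zero_iff.1 hu]
    | cons b p ih =>
      intro u hu
      cases u with
      | nil => simp at hu
      | cons c u =>
        have := ih u (by simpa using hu)
        simp only [List.zipWith_cons_cons, List.sum_cons, this]
        omega
  rw [key π' u hu]
  omega

theorem OccursAt.length_sum {π π' τ : OrderedPartition} {l : ℕ} (h : OccursAt π π' τ l) :
    τ.1.length + 1 = π.1.length + π'.1.length ∧ τ.1.sum + 1 = π.1.sum + π'.1.sum := by
  obtain ⟨hl, ρ, hρ, hτ⟩ := h
  have h1 := hρ.length_eq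
  have h2 := hρ.sum_eq
  have h3 : π.1.sum = (π.1.take l).sum + (π.1.getD l 0 + (π.1.drop (l + 1)).sum) := by
    conv_lhs => rw [← List.take_append_drop l π.1, List.sum_append,
      List.drop_eq_getElem_cons hl, List.sum_cons]
    simp [List.getD_eq_getElem?_getD, hl]
  rw [hτ]
  simp only [List.length_append, List.length_take, List.length_drop, List.sum_append]
  omega

/-- Only finitely many products `π ∗ π'` contain a given `τ`. -/
theorem finite_setOf_occurs (τ : OrderedPartition) :
    {q : OrderedPartition × OrderedPartition | Occurs q.1 q.2 τ}.Finite := by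
  set B : Set OrderedPartition :=
    {π | π.1.length ≤ τ.1.length ∧ π.1.sum ≤ τ.1.sum + 1} with hB
  have hfin : B.Finite := by
    have hL : {L : List ℕ | L.length ≤ τ.1.length ∧ L.sum ≤ τ.1.sum + 1}.Finite := by
      refine ((List.finite_length_le (Fin (τ.1.sum + 2)) τ.1.length).image
        (List.map Fin.val)).subset ?_
      rintro L ⟨h1, h2⟩
      have h3 : ∀ b ∈ L, b < τ.1.sum + 2 := fun b hb => by
        have := List.single_le_sum (l := L) (fun _ _ => Nat.zero_le _) b hb
        omega
      exact ⟨L.pmap (fun b hb => ⟨b, hb⟩) h3, by simpa using h1, by simp [List.map_pmap]⟩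
    exact hL.preimage Subtype.val_injective.injOn
  refine (hfin.prod hfin).subset ?_
  rintro ⟨π, π'⟩ ⟨l, hl⟩
  have h := hl.length_sum
  have h1 : 1 ≤ π.1.length := List.length_pos_iff.2 π.2
  have h2 : 1 ≤ π'.1.length := List.length_pos_iff.2 π'.2
  constructor <;> constructor <;> dsimp only at h ⊢ <;> omega

end OrderedPartition

/-! ### Words, shuffles, subdivisions and Koszul signs -/

/-- All interleavings of two words that keep the order inside each of them. -/
def interleave : List ℕ → List ℕ → List (List ℕ)
  | [], ys => [ys]
  | xs, [] => [xs]
  | x :: xs, y :: ys =>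
      (interleave xs (y :: ys)).map (x :: ·) ++ (interleave (x :: xs) ys).map (y :: ·)

/-- The terms of `{b⁽¹⁾}⋯{b⁽ˢ⁾}`: all arrangements of all the letters that keep the order inside
each word `b⁽ˡ⁾`. -/
def shuffles : List (List ℕ) → List (List ℕ)
  | [] => [[]]
  | w :: ws => (shuffles ws).flatMap (interleave w)

/-- All ways of writing a word as `b ++ c ++ d` with `c` of length `j`. -/
def splittings (j : ℕ) (w : List ℕ) : List (List ℕ × List ℕ × List ℕ) :=
  (List.range (w.length + 1 - j)).map fun p => (w.take p, (w.drop p).take j, w.drop (p + j))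

/-- All subdivisions `a⁽ˡ⁾ = (b⁽ˡ⁾, c⁽ˡ⁾, d⁽ˡ⁾)`, `l = 1, …, s`, with `c⁽ˡ⁾` of length `j_l`. -/
def subdivisions (π' : List ℕ) (ws : List (List ℕ)) :
    List (List (List ℕ × List ℕ × List ℕ)) :=
  (List.zipWith splittings π' ws).sections

/-- The argument positions `o, o + 1, …` distributed over the slots `(k₁|⋯|k_t)`. -/
def slotWords : ℕ → List ℕ → List (List ℕ)
  | _, [] => []
  | o, k :: ks => List.range' o k :: slotWords (o + k) ks

/-- Koszul sign of a word of positions: a factor `(-1)^(w p * w q)` for each pair of positions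
`q < p` such that `p` stands before `q` in the word. -/
def wordSign (w : ℕ → ℤ) : List ℕ → ℤˣ
  | [] => 1
  | p :: L => ((L.filter (· < p)).map fun q => (w p * w q).negOnePow).prod * wordSign w L

/-- Koszul sign of the rearrangement `(a_{σ 0}, a_{σ 1}, …)` of elements of degrees `e`. -/
def permKoszulSign {n : ℕ} (σ : Equiv.Perm (Fin n)) (e : Fin n → ℤ) : ℤˣ :=
  ∏ i : Fin n, ∏ j : Fin n, if i < j ∧ σ j < σ i then (e (σ i) * e (σ j)).negOnePow else 1

/-- The antisymmetric Koszul sign: sign of the permutation times the Koszul sign. -/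
def antiKoszulSign {n : ℕ} (σ : Equiv.Perm (Fin n)) (e : Fin n → ℤ) : ℤˣ :=
  Equiv.Perm.sign σ * permKoszulSign σ e

/-- The entry of a finite sequence at a natural number position (zero outside the range). -/
def entry {α : Type*} [Zero α] {n : ℕ} (a : Fin n → α) (p : ℕ) : α :=
  if h : p < n then a ⟨p, h⟩ else 0

/-! ### Graded vector spaces and multilinear maps -/

section Graded

variable {k V : Type*} [Field k] [AddCommGroup V] [Module k V]

/-- The space of `n`-linear maps on `V` with values in `V`. -/
abbrev MultiMap (k V : Type*) [Field k] [AddCommGroup V] [Module k V] (n : ℕ) : Type _ :=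
  MultilinearMap k (fun _ : Fin n => V) V

/-- Collections of partitioned multilinear maps, one of each type. A map of type `(i₁|⋯|i_r)` is an
`(i₁+⋯+i_r)`-linear map. -/
abbrev PartitionedMaps (k V : Type*) [Field k] [AddCommGroup V] [Module k V] : Type _ :=
  (π : OrderedPartition) → MultiMap k V π.arity

variable (𝒜 : ℤ → Submodule k V)

/-- The entries of `a` are homogeneous, of degrees `e`. -/
def HomogeneousTuple {n : ℕ} (e : Fin n → ℤ) (a : Fin n → V) : Prop := ∀ i, a i ∈ 𝒜 (e i)

/-- The map `x` changes the total super degree of its arguments by `s`. -/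
def HasSuperDegree {n : ℕ} (x : MultiMap k V n) (s : ℤ) : Prop :=
  ∀ (e : Fin n → ℤ) (a : Fin n → V), HomogeneousTuple 𝒜 e a → x a ∈ 𝒜 (∑ i, e i + s)

variable [DirectSum.Decomposition 𝒜]

/-- The projection of `V` onto the sum of its components of degree `≡ p (mod 2)`. -/
def parityProj (p : ZMod 2) : V →ₗ[k] V :=
  (DirectSum.decomposeLinearEquiv 𝒜).symm.toLinearMap ∘ₗ
    DirectSum.lmap (fun i : ℤ => if (i : ZMod 2) = p then LinearMap.id else 0) ∘ₗ
      (DirectSum.decomposeLinearEquiv 𝒜).toLinearMap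

theorem parityProj_of_mem (p : ZMod 2) {i : ℤ} {v : V} (hv : v ∈ 𝒜 i) :
    parityProj 𝒜 p v = if (i : ZMod 2) = p then v else 0 := by
  lift v to 𝒜 i using hv
  simp only [parityProj, LinearMap.comp_apply, LinearEquiv.coe_coe,
    DirectSum.decomposeLinearEquiv_apply, DirectSum.decompose_coe]
  rw [← DirectSum.lof_eq_of k, DirectSum.lmap_lof, DirectSum.decomposeLinearEquiv_symm_apply,
    DirectSum.lof_eq_of, DirectSum.decompose_symm_of]
  split_ifs <;> simp

/-- The linear operator `a ↦ (-1)^‖a‖ a`, where `‖a‖ = d(a) + |a| = |a| - 1`. -/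
def shiftSign : Module.End k V := parityProj 𝒜 1 - parityProj 𝒜 0

theorem shiftSign_of_mem {i : ℤ} {v : V} (hv : v ∈ 𝒜 i) :
    shiftSign 𝒜 v = (i - 1).negOnePow • v := by
  rw [shiftSign, LinearMap.sub_apply, parityProj_of_mem 𝒜 1 hv, parityProj_of_mem 𝒜 0 hv]
  rcases Int.even_or_odd i with h | h
  · have h0 : (i : ZMod 2) = 0 := (ZMod.intCast_zmod_eq_zero_iff_dvd i 2).2 h.two_dvd
    rw [h0, Int.negOnePow_odd (i - 1) (h.sub_odd odd_one)]
    simp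
  · have h1 : (i : ZMod 2) = 1 := by
      obtain ⟨c, rfl⟩ := h
      push_cast
      rw [show (2 : ZMod 2) = 0 from rfl]
      simp
    rw [h1, Int.negOnePow_even (i - 1) (h.sub_odd odd_one)]
    simp

/-- The modification
`x̃(a₁,…,a_n) = (-1)^((n-1)‖a₁‖ + (n-2)‖a₂‖ + ⋯ + ‖a_{n-1}‖) x(a₁,…,a_n)`. -/
def tildeMap {n : ℕ} (x : MultiMap k V n) : MultiMap k V n :=
  x.compLinearMap fun i : Fin n => shiftSign 𝒜 ^ (n - 1 - (i : ℕ))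

/-! ### Composition of partitioned maps and the master identity -/

open Classical in
/-- The value `{x(π)}{y(π')}{a⁽¹⁾|⋯|a⁽ᵗ⁾}` of the component of type `τ = (k₁|⋯|k_t)` of the
composition `{x(π)}{y(π')}`, on homogeneous elements `a` of degrees `e`; `ny` is the degree `‖y‖`.
For each slot `l` of `π` from which `τ` arises, and for each subdivision of the
`s` consecutive slots of `τ` that replace it, the term is
`± x(a⁽¹⁾|⋯|{b⁽¹⁾}⋯{b⁽ˢ⁾}, y(c⁽¹⁾|⋯|c⁽ˢ⁾), {d⁽¹⁾}⋯{d⁽ˢ⁾}|⋯|a⁽ᵗ⁾)`, where an interchange of two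
symbols `u`, `v` with respect to `x, y, a₁, …, a_n` costs `(-1)^(‖u‖‖v‖)`. -/
noncomputable def composeAt {π π' : OrderedPartition} (x : MultiMap k V π.arity)
    (y : MultiMap k V π'.arity) (ny : ℤ) (τ : OrderedPartition)
    (e : Fin τ.arity → ℤ) (a : Fin τ.arity → V) : V :=
  ∑ l ∈ Finset.range π.1.length,
    if OrderedPartition.OccursAt π π' τ l then
      let slots := slotWords 0 τ.1
      let before := (slots.take l).flatten
      let after := (slots.drop (l + π'.1.length)).flatten
      let w : ℕ → ℤ := fun p => entry e p - 1
      ((subdivisions π'.1 ((slots.drop l).take π'.1.length)).map fun S =>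
        ((shuffles (S.map fun t => t.1)).map fun β =>
          ((shuffles (S.map fun t => t.2.2)).map fun δ =>
            let γ := (S.map fun t => t.2.1).flatten
            let yc : V := y fun i => (γ.map (entry a)).getD i 0
            ((ny * ((before ++ β).map w).sum).negOnePow *
                wordSign w (before ++ β ++ γ ++ δ ++ after)) •
              x fun i => ((before ++ β).map (entry a) ++ [yc] ++
                (δ ++ after).map (entry a)).getD i 0).sum).sum).sum
    else 0

theorem occurs_of_composeAt_ne_zero {π π' : OrderedPartition} (x : MultiMap k V π.arity)
    (y : MultiMap k V π'.arity) (ny : ℤ) (τ : OrderedPartition)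
    (e : Fin τ.arity → ℤ) (a : Fin τ.arity → V) (h : composeAt x y ny τ e a ≠ 0) :
    OrderedPartition.Occurs π π' τ := by
  by_contra hn
  refine h (Finset.sum_eq_zero fun l _ => if_neg fun hl => hn ⟨l, hl⟩)

/-- The super degree of `m(π)` modulo 2, namely `d(π) + d̄(π) + 1`. -/
def OrderedPartition.superParity (π : OrderedPartition) : ℤ := π.d + π.dBar + 1

/-- The part of type `τ` of the identity `{m̃}{m̃} = 0`, for `m = ∑_π m(π)` with
`|m(π)| ≡ d(π) + d̄(π) + 1 (mod 2)`: the sum of all maps of type `τ` in the compositions of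
`m̃(π)` and `m̃(π')` vanishes. All but finitely many terms vanish. -/
def MasterPart (m : PartitionedMaps k V) (τ : OrderedPartition) : Prop :=
  ∀ (e : Fin τ.arity → ℤ) (a : Fin τ.arity → V), HomogeneousTuple 𝒜 e a →
    ∑ᶠ q : OrderedPartition × OrderedPartition,
      composeAt (tildeMap 𝒜 (m q.1)) (tildeMap 𝒜 (m q.2)) (q.2.d + q.2.superParity) τ e a = 0

/-- The data underlying a homotopy Gerstenhaber algebra: the degrees of the maps `m(π)`, and
`m(1|0) = m(0|1) = id` being the only nonzero ones among those `m(π)` where `π` has a zero slot. -/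
structure IsGInftyData (m : PartitionedMaps k V) : Prop where
  degree : ∀ π, ∃ s : ℤ, s ≡ π.superParity [ZMOD 2] ∧ HasSuperDegree 𝒜 (m π) s
  one_zero : ∀ a, m (OrderedPartition.pair 1 0) a = a ⟨0, by decide⟩
  zero_one : ∀ a, m (OrderedPartition.pair 0 1) a = a ⟨0, by decide⟩
  irregular : ∀ π : OrderedPartition, ¬ π.Regular → π ≠ OrderedPartition.pair 1 0 →
    π ≠ OrderedPartition.pair 0 1 → m π = 0

/-- Homotopy Gerstenhaber (`G∞`) algebras: the master identity `{m̃}{m̃} = 0` holds, that is,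
its part of type `τ` holds for every regular partition `τ`. -/
structure IsGInfty (m : PartitionedMaps k V) : Prop extends IsGInftyData 𝒜 m where
  master : ∀ τ : OrderedPartition, τ.Regular → MasterPart 𝒜 m τ

/-- The weaker notion in which the part of type `τ` of the master identity is dropped
whenever `m(τ)` is identically zero. -/
structure IsReducedGInfty (m : PartitionedMaps k V) : Prop extends IsGInftyData 𝒜 m where
  master : ∀ τ : OrderedPartition, τ.Regular → m τ ≠ 0 → MasterPart 𝒜 m τ

/-- The one-slot part `m_A = m(0) + m(1) + m(2) + ⋯`, as a collection of partitioned maps. -/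
def oneSlotPart (m : PartitionedMaps k V) : PartitionedMaps k V :=
  fun π => if π.1.length = 1 then m π else 0

/-- The map `m(n)`, as an ordinary `n`-linear map. -/
def oneSlotMap (m : PartitionedMaps k V) (n : ℕ) : MultiMap k V n :=
  (m (OrderedPartition.single n)).domDomCongr
    (finCongr (show (OrderedPartition.single n).arity = n from List.sum_singleton))

/-! ### `A∞` algebras -/

/-- The value of Gerstenhaber's composition `{x}{y}{a₁,…,a_n}` of ordinary multilinear maps, an
`i`-linear `y` of degree `‖y‖ = ny` and a `j`-linear `x`, `i + j = n + 1`, on homogeneous elements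
of degrees `e`:
`∑_p (-1)^(‖y‖(‖a₁‖+⋯+‖a_p‖)) x(a₁,…,a_p, y(a_{p+1},…,a_{p+i}), a_{p+i+1},…,a_n)`. -/
def braceAt {i j n : ℕ} (x : MultiMap k V j) (y : MultiMap k V i) (ny : ℤ)
    (e : Fin n → ℤ) (a : Fin n → V) : V :=
  ∑ p ∈ Finset.range j, (ny * ∑ q ∈ Finset.range p, (entry e q - 1)).negOnePow •
    x fun q : Fin j =>
      if (q : ℕ) < p then entry a q
      else if (q : ℕ) = p then y fun r : Fin i => entry a (p + r)
      else entry a (q + i - 1)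

/-- The part of arity `n` of `{m̃}{m̃} = 0` for `m = m(1) + m(2) + ⋯` with `|m(i)| ≡ i (mod 2)`,
so that `‖m(i)‖ ≡ (i - 1) + i`. -/
def AInftyRelation (m : (n : ℕ) → MultiMap k V n) (n : ℕ) : Prop :=
  ∀ (e : Fin n → ℤ) (a : Fin n → V), HomogeneousTuple 𝒜 e a →
    ∑ i ∈ Finset.Icc 1 n,
      braceAt (tildeMap 𝒜 (m (n + 1 - i))) (tildeMap 𝒜 (m i)) ((i : ℤ) - 1 + i) e a = 0

/-- The data underlying an `A∞` algebra: maps `m(1), m(2), …` with `|m(n)| ≡ n (mod 2)`. -/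
structure IsAInftyData (m : (n : ℕ) → MultiMap k V n) : Prop where
  zero : m 0 = 0
  degree : ∀ n : ℕ, 1 ≤ n → ∃ s : ℤ, s ≡ (n : ℤ) [ZMOD 2] ∧ HasSuperDegree 𝒜 (m n) s

/-- `A∞` algebras. -/
structure IsAInfty (m : (n : ℕ) → MultiMap k V n) : Prop extends IsAInftyData 𝒜 m where
  relation : ∀ n, 1 ≤ n → AInftyRelation 𝒜 m n

/-! ### `L∞` algebras -/

/-- The graded antisymmetrization
`(a₁,…,a_n) ↦ ∑_σ χ(σ; a) x(a_{σ(1)},…,a_{σ(n)})` over all permutations, with `χ` the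
antisymmetric Koszul sign. It is written as a multilinear map by splitting each argument into its
even and odd parts; see `gradedAntisymm_apply`. -/
def gradedAntisymm {n : ℕ} (x : MultiMap k V n) : MultiMap k V n :=
  ∑ σ : Equiv.Perm (Fin n), ∑ ε : Fin n → ZMod 2,
    (antiKoszulSign σ (fun i => ((ε i).val : ℤ)) : ℤ) •
      (x.domDomCongr σ).compLinearMap fun i => parityProj 𝒜 (ε i)

theorem gradedAntisymm_apply {n : ℕ} (x : MultiMap k V n) (e : Fin n → ℤ) (a : Fin n → V)
    (ha : HomogeneousTuple 𝒜 e a) :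
    gradedAntisymm 𝒜 x a = ∑ σ : Equiv.Perm (Fin n), antiKoszulSign σ e • x (a ∘ σ) := by
  simp only [gradedAntisymm, sum_apply]
  refine Finset.sum_congr rfl fun σ _ => ?_
  rw [Finset.sum_eq_single (fun i => ((e i : ℤ) : ZMod 2))]
  · rw [smul_apply, MultilinearMap.compLinearMap_apply,
      MultilinearMap.domDomCongr_apply]
    have h1 : (fun i => (parityProj 𝒜 ((e (σ i) : ℤ) : ZMod 2)) (a (σ i))) = a ∘ σ := by
      funext i
      simp [parityProj_of_mem 𝒜 _ (ha (σ i))]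
    have h2 : antiKoszulSign σ (fun i => ((((e i : ℤ) : ZMod 2)).val : ℤ)) =
        antiKoszulSign σ e := by
      simp only [antiKoszulSign, permKoszulSign]
      congr 1
      refine Finset.prod_congr rfl fun i _ => Finset.prod_congr rfl fun j _ => ?_
      split_ifs
      · rw [Int.negOnePow_eq_iff]
        rw [even_iff_two_dvd]
        refine (ZMod.intCast_zmod_eq_zero_iff_dvd _ 2).1 ?_
        push_cast
        simp
      · rfl
    rw [h1, h2]
    rfl
  · intro ε _ hε
    obtain ⟨i, hi⟩ := Function.ne_iff.1 hε
    rw [smul_apply, MultilinearMap.compLinearMap_apply,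
      MultilinearMap.domDomCongr_apply]
    rw [MultilinearMap.map_coord_zero _ (σ.symm i)]
    · simp
    · simp [parityProj_of_mem 𝒜 _ (ha i), Ne.symm hi]
  · simp

/-- `σ` is increasing on the first `i` positions and on the remaining ones. -/
def IsUnshuffle {n : ℕ} (i : ℕ) (σ : Equiv.Perm (Fin n)) : Prop :=
  ∀ p q : Fin n, p < q → ((q : ℕ) < i ∨ i ≤ (p : ℕ)) → σ p < σ q

/-- Graded antisymmetry. -/
def IsGradedAntisymm {n : ℕ} (l : MultiMap k V n) : Prop :=
  ∀ (σ : Equiv.Perm (Fin n)) (e : Fin n → ℤ) (a : Fin n → V), HomogeneousTuple 𝒜 e a →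
    l (a ∘ σ) = antiKoszulSign σ e • l a

open Classical in
/-- The generalized Jacobi identity with `n` arguments:
`∑_i (-1)^i ∑_σ χ(σ; a) l_{n+1-i}(l_i(a_{σ(1)},…,a_{σ(i)}), a_{σ(i+1)},…,a_{σ(n)}) = 0`,
the inner sum over the unshuffles. -/
def LInftyRelation (l : (n : ℕ) → MultiMap k V n) (n : ℕ) : Prop :=
  ∀ (e : Fin n → ℤ) (a : Fin n → V), HomogeneousTuple 𝒜 e a →
    ∑ i ∈ Finset.Icc 1 n, (i : ℤ).negOnePow •
      ∑ σ : Equiv.Perm (Fin n) with IsUnshuffle i σ, antiKoszulSign σ e •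
        l (n + 1 - i) (fun q : Fin (n + 1 - i) =>
          if (q : ℕ) = 0 then l i fun r : Fin i => entry (a ∘ σ) r
          else entry (a ∘ σ) (q + i - 1)) = 0

/-- The data underlying an `L∞` algebra: graded antisymmetric maps `l(1), l(2), …` with
`|l(n)| ≡ n (mod 2)`. -/
structure IsLInftyData (l : (n : ℕ) → MultiMap k V n) : Prop where
  zero : l 0 = 0
  degree : ∀ n : ℕ, 1 ≤ n → ∃ s : ℤ, s ≡ (n : ℤ) [ZMOD 2] ∧ HasSuperDegree 𝒜 (l n) s
  antisymm : ∀ n, IsGradedAntisymm 𝒜 (l n)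

/-- `L∞` algebras. -/
structure IsLInfty (l : (n : ℕ) → MultiMap k V n) : Prop extends IsLInftyData 𝒜 l where
  relation : ∀ n, 1 ≤ n → LInftyRelation 𝒜 l n

end Graded

/-! ### Products over pairs and Koszul signs of permutations -/

section KoszulSign

/-! If `τ` occurs in `π * π'`, the numbers of slots satisfy `#τ + 1 = #π + #π'`. Hence `τ` has one
slot exactly when both factors do. So the part of type `(n)` of the master identity sees only the
one-slot maps and is the same for `m` and `m_A`, while for `m_A` the parts with several slots are
trivially zero. In type `(n)` each shuffle involves a single word, hence is trivial, and the
composition is Gerstenhaber's brace (`composeAt_single`). The map `m(0)` vanishes because `(0)` is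
irregular, so the part of type `(n)` is precisely the `A∞` relation with `n` arguments
(`masterPart_single_iff`).

The `L∞` relation is the graded symmetrization of the `A∞` relation in the shifted degrees `‖a‖ =
|a| - 1`. The signs in `m̃` turn the antisymmetric Koszul sign for `|a|` into the plain Koszul sign
for `‖a‖` (`antiKoszulSign_mul_tildeSign`), so antisymmetrizing `m(n)` is symmetrizing `m̃(n)` up to
a global sign. Every permutation is uniquely an unshuffle times a block permutation, and an
arrangement of `(Y, B₁, …, B_M)` is a place `p` for `Y` with an arrangement of the `B`s. Moving the
arguments of `Y` to place `p` identifies nested symmetrizations, summed over unshuffles, with the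
symmetrized brace (`sum_unshuffle_symm_comp`). The leftover sign `(-1)^(n-i)` combines with the
`(-1)^i` of the generalized Jacobi identity into a factor independent of `i`.

Everything happens in one fixed arity `n`, which is why the reduced case follows from the same
lemmas. -/

theorem Int.negOnePow_sum {ι : Type*} (s : Finset ι) (f : ι → ℤ) :
    (∑ r ∈ s, f r).negOnePow = ∏ r ∈ s, (f r).negOnePow := by
  classical
  induction s using Finset.induction_on with
  | empty => simp
  | insert a s ha ih => rw [Finset.sum_insert ha, Finset.prod_insert ha, Int.negOnePow_add, ih]

variable {n : ℕ}

/-- A product over all pairs `i < j` of a symmetric function is invariant under permutations. -/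
theorem prod_lt_comp_perm {M : Type*} [CommMonoid M] (σ : Equiv.Perm (Fin n))
    {f : Fin n → Fin n → M} (hf : ∀ i j, f i j = f j i) :
    ∏ i, ∏ j, (if i < j then f (σ i) (σ j) else 1) = ∏ i, ∏ j, if i < j then f i j else 1 := by
  simp_rw [← Finset.prod_product', ← Finset.prod_filter]
  refine Finset.prod_nbij'
    (fun q => if σ q.1 < σ q.2 then (σ q.1, σ q.2) else (σ q.2, σ q.1))
    (fun q => if σ.symm q.1 < σ.symm q.2 then (σ.symm q.1, σ.symm q.2)
      else (σ.symm q.2, σ.symm q.1)) ?_ ?_ ?_ ?_ ?_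
  · rintro ⟨i, j⟩ h
    have hij : i < j := by simpa using h
    have hne : σ i ≠ σ j := σ.injective.ne hij.ne
    dsimp only
    split_ifs with h1
    · simpa using h1
    · simpa using lt_of_le_of_ne (not_lt.1 h1) hne.symm
  · rintro ⟨i, j⟩ h
    have hij : i < j := by simpa using h
    have hne : σ.symm i ≠ σ.symm j := σ.symm.injective.ne hij.ne
    dsimp only
    split_ifs with h1
    · simpa using h1
    · simpa using lt_of_le_of_ne (not_lt.1 h1) hne.symm
  · rintro ⟨i, j⟩ h
    have hij : i < j := by simpa using h
    dsimp only
    split_ifs with h1 h2 h3 <;> simp_all [not_lt.2 hij.le]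
  · rintro ⟨i, j⟩ h
    have hij : i < j := by simpa using h
    dsimp only
    split_ifs with h1 h2 h3 <;> simp_all [not_lt.2 hij.le]
  · rintro ⟨i, j⟩ _
    dsimp only
    split_ifs
    · rfl
    · exact hf _ _

theorem permKoszulSign_eq_prod_lt (σ : Equiv.Perm (Fin n)) (w : Fin n → ℤ) :
    permKoszulSign σ w = ∏ i, ∏ j, if i < j then
      (if σ j < σ i then (w (σ i) * w (σ j)).negOnePow else 1) else 1 := by
  simp only [permKoszulSign, ite_and]

/-- Cocycle rule: a pair is inverted by the product exactly when one of the two factors inverts it,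
and a pair inverted twice contributes a square, which is `1`. -/
theorem permKoszulSign_mul (σ τ : Equiv.Perm (Fin n)) (w : Fin n → ℤ) :
    permKoszulSign (σ * τ) w = permKoszulSign σ w * permKoszulSign τ (w ∘ σ) := by
  -- The contribution of an unordered pair to the sign of `σ`, made symmetric so that the product
  -- over pairs can be reindexed by `τ`.
  let f : Fin n → Fin n → ℤˣ := fun x y =>
    if (x < y ∧ σ y < σ x) ∨ (y < x ∧ σ x < σ y) then (w (σ x) * w (σ y)).negOnePow else 1
  have hf : ∀ x y, f x y = f y x := fun x y => by
    simp only [f, or_comm, mul_comm]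
  have h1 : permKoszulSign σ w = ∏ i, ∏ j, if i < j then f (τ i) (τ j) else 1 := by
    rw [prod_lt_comp_perm τ hf, permKoszulSign_eq_prod_lt]
    refine Finset.prod_congr rfl fun i _ => Finset.prod_congr rfl fun j _ => ?_
    by_cases h : i < j
    · simp [f, h, not_lt.2 h.le]
    · simp [h]
  rw [h1, permKoszulSign_eq_prod_lt, permKoszulSign_eq_prod_lt]
  simp_rw [← Finset.prod_mul_distrib]
  refine Finset.prod_congr rfl fun i _ => Finset.prod_congr rfl fun j _ => ?_
  by_cases h : i < j
  swap
  · simp [h]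
  simp only [if_pos h]
  have hne : τ i ≠ τ j := τ.injective.ne h.ne
  have hne' : σ (τ i) ≠ σ (τ j) := σ.injective.ne hne
  simp only [f, Equiv.Perm.mul_apply, Function.comp_apply]
  rcases lt_or_gt_of_ne hne with h2 | h2 <;> rcases lt_or_gt_of_ne hne' with h3 | h3 <;>
    simp [h2, h3, not_lt.2 h2.le, not_lt.2 h3.le]

@[simp]
theorem permKoszulSign_one (w : Fin n → ℤ) : permKoszulSign 1 w = 1 := by
  rw [permKoszulSign_eq_prod_lt]
  refine Finset.prod_eq_one fun i _ => Finset.prod_eq_one fun j _ => ?_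
  split_ifs with h h2
  · exact absurd h (not_lt.2 h2.le)
  all_goals rfl

theorem antiKoszulSign_mul (σ τ : Equiv.Perm (Fin n)) (w : Fin n → ℤ) :
    antiKoszulSign (σ * τ) w = antiKoszulSign σ w * antiKoszulSign τ (w ∘ σ) := by
  simp only [antiKoszulSign, permKoszulSign_mul, Equiv.Perm.sign_mul]
  exact mul_mul_mul_comm _ _ _ _

/-- The sign `(-1)^((n-1)w₁ + (n-2)w₂ + ⋯ + w_{n-1})`. -/
def tildeSign (w : Fin n → ℤ) : ℤˣ := ∏ i, (w i).negOnePow ^ (n - 1 - (i : ℕ))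

theorem tildeSign_mul_self (w : Fin n → ℤ) : tildeSign w * tildeSign w = 1 :=
  Int.units_mul_self _

theorem tildeSign_eq_prod_lt (w : Fin n → ℤ) :
    tildeSign w = ∏ i, ∏ j, if i < j then (w i).negOnePow else 1 := by
  refine Finset.prod_congr rfl fun i _ => ?_
  rw [← Finset.prod_filter, Finset.prod_const, Finset.filter_lt_eq_Ioi, Fin.card_Ioi]

/-- The two Koszul signs agree after the shift of degrees. -/
theorem antiKoszulSign_mul_tildeSign (σ : Equiv.Perm (Fin n)) (e : Fin n → ℤ) :
    antiKoszulSign σ e * tildeSign (fun i => e i - 1) =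
      permKoszulSign σ (fun i => e i - 1) * tildeSign (fun i => e (σ i) - 1) := by
  -- In each pair the smaller index contributes; written with `min` this is symmetric, so the pairs
  -- can be reindexed by `σ` and both sides compared pair by pair.
  have h1 : tildeSign (fun i => e i - 1) =
      ∏ i, ∏ j, if i < j then (e (min (σ i) (σ j)) - 1).negOnePow else 1 := by
    rw [prod_lt_comp_perm σ (f := fun i j => (e (min i j) - 1).negOnePow)
      (fun i j => by rw [min_comm]), tildeSign_eq_prod_lt]
    refine Finset.prod_congr rfl fun i _ => Finset.prod_congr rfl fun j _ => ?_
    split_ifs with h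
    · rw [min_eq_left h.le]
    · rfl
  have h2 : Equiv.Perm.sign σ = ∏ i, ∏ j, if i < j then (if σ j < σ i then -1 else 1) else 1 := by
    rw [Equiv.Perm.sign_eq_prod_prod_Ioi]
    refine Finset.prod_congr rfl fun i _ => ?_
    rw [← Finset.prod_filter, Finset.filter_lt_eq_Ioi]
    refine Finset.prod_congr rfl fun j hj => ?_
    have hne : σ i ≠ σ j := σ.injective.ne (Finset.mem_Ioi.1 hj).ne
    rcases lt_or_gt_of_ne hne with h | h <;> simp [h, not_lt.2 h.le]
  rw [h1, antiKoszulSign, h2, permKoszulSign_eq_prod_lt, permKoszulSign_eq_prod_lt,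
    tildeSign_eq_prod_lt]
  simp_rw [← Finset.prod_mul_distrib]
  refine Finset.prod_congr rfl fun i _ => Finset.prod_congr rfl fun j _ => ?_
  split_ifs with h h2
  -- For an inverted pair of degrees `a = e (σ i)`, `b = e (σ j)` the exponents are `1 + ab + (b -
  -- 1)` and `(a - 1)(b - 1) + (a - 1)`; they differ by `2b`.
  · rw [min_eq_right h2.le, ← Int.negOnePow_one, ← Int.negOnePow_add, ← Int.negOnePow_add,
      ← Int.negOnePow_add, Int.negOnePow_eq_iff]
    exact ⟨e (σ j), by ring⟩
  · rw [min_eq_left (not_lt.1 h2), one_mul]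
  · simp

end KoszulSign

/-! ### Block permutations and unshuffles -/

section Blocks

variable {i M : ℕ}

/-- The permutation acting by `τ` on the first `i` positions and by `ρ` on the last `M`. -/
def blockPerm (τ : Equiv.Perm (Fin i)) (ρ : Equiv.Perm (Fin M)) : Equiv.Perm (Fin (i + M)) :=
  finSumFinEquiv.permCongr (Equiv.sumCongr τ ρ)

@[simp]
theorem blockPerm_castAdd (τ : Equiv.Perm (Fin i)) (ρ : Equiv.Perm (Fin M)) (r : Fin i) :
    blockPerm τ ρ (Fin.castAdd M r) = Fin.castAdd M (τ r) := by
  simp [blockPerm, Equiv.permCongr_apply]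

@[simp]
theorem blockPerm_natAdd (τ : Equiv.Perm (Fin i)) (ρ : Equiv.Perm (Fin M)) (r : Fin M) :
    blockPerm τ ρ (Fin.natAdd i r) = Fin.natAdd i (ρ r) := by
  simp [blockPerm, Equiv.permCongr_apply]

theorem blockPerm_mul (τ τ' : Equiv.Perm (Fin i)) (ρ ρ' : Equiv.Perm (Fin M)) :
    blockPerm (τ * τ') (ρ * ρ') = blockPerm τ ρ * blockPerm τ' ρ' := by
  ext x
  refine Fin.addCases (fun r => ?_) (fun r => ?_) x <;> simp

@[simp]
theorem blockPerm_one : blockPerm (1 : Equiv.Perm (Fin i)) (1 : Equiv.Perm (Fin M)) = 1 := by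
  ext x
  refine Fin.addCases (fun r => ?_) (fun r => ?_) x <;> simp

theorem blockPerm_injective {τ τ' : Equiv.Perm (Fin i)} {ρ ρ' : Equiv.Perm (Fin M)}
    (h : blockPerm τ ρ = blockPerm τ' ρ') : τ = τ' ∧ ρ = ρ' := by
  constructor
  · ext r
    simpa using congrArg Fin.val (Equiv.congr_fun h (Fin.castAdd M r))
  · ext r
    simpa using congrArg Fin.val (Equiv.congr_fun h (Fin.natAdd i r))

theorem permKoszulSign_blockPerm (τ : Equiv.Perm (Fin i)) (ρ : Equiv.Perm (Fin M))
    (w : Fin (i + M) → ℤ) :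
    permKoszulSign (blockPerm τ ρ) w =
      permKoszulSign τ (w ∘ Fin.castAdd M) * permKoszulSign ρ (w ∘ Fin.natAdd i) := by
  have h0 : ∀ x y : Fin i, Fin.castAdd M x < Fin.castAdd M y ↔ x < y := fun _ _ => Iff.rfl
  have h1 : ∀ (x : Fin i) (y : Fin M), ¬ Fin.natAdd i y < Fin.castAdd M x := fun x y => by
    simp only [Fin.lt_def, Fin.val_natAdd, Fin.val_castAdd]; omega
  simp [permKoszulSign, Fin.prod_univ_add, h0, h1, Finset.prod_mul_distrib]

/-- Weak monotonicity suffices since `σ` is injective; this form matches the sorting lemmas for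
tuples. -/
theorem isUnshuffle_iff (σ : Equiv.Perm (Fin (i + M))) :
    IsUnshuffle i σ ↔ Monotone (σ ∘ Fin.castAdd M) ∧ Monotone (σ ∘ Fin.natAdd i) := by
  constructor
  · intro h
    constructor
    · intro r s hrs
      rcases hrs.eq_or_lt with rfl | hlt
      · rfl
      · exact (h _ _ hlt (Or.inl (by simp))).le
    · intro r s hrs
      rcases hrs.eq_or_lt with rfl | hlt
      · rfl
      · exact (h _ _ ((Fin.natAdd_lt_natAdd_iff i).2 hlt) (Or.inr (by simp))).le
  · rintro ⟨h1, h2⟩ p q hpq hor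
    refine lt_of_le_of_ne ?_ (σ.injective.ne hpq.ne)
    rcases hor with hq | hp
    · exact h1 (a := ⟨p, lt_trans hpq hq⟩) (b := ⟨q, hq⟩) hpq.le
    · have hp' : p = Fin.natAdd i ⟨p - i, by omega⟩ := by ext; simp; omega
      have hq' : q = Fin.natAdd i ⟨q - i, by omega⟩ := by
        ext; simp only [Fin.lt_def] at hpq; simp; omega
      rw [hp', hq']
      exact h2 (by simp only [Fin.le_def] at *; omega)

open Classical in
/-- Every permutation is uniquely an unshuffle times a block permutation. -/
theorem sum_unshuffle_blockPerm {G : Type*} [AddCommMonoid G]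
    (F : Equiv.Perm (Fin (i + M)) → G) :
    ∑ u : Equiv.Perm (Fin (i + M)) with IsUnshuffle i u,
      ∑ τ : Equiv.Perm (Fin i), ∑ ρ : Equiv.Perm (Fin M), F (u * blockPerm τ ρ) = ∑ σ, F σ := by
  simp_rw [← Finset.sum_product']
  refine Finset.sum_bij (fun q _ => q.1 * blockPerm q.2.1 q.2.2) (fun _ _ => Finset.mem_univ _)
    ?_ ?_ (fun _ _ => rfl)
  · rintro ⟨u, τ, ρ⟩ hu ⟨u', τ', ρ'⟩ hu' h
    simp only [Finset.mem_product, Finset.mem_filter, Finset.mem_univ, true_and, and_true,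
      isUnshuffle_iff] at hu hu'
    dsimp only at h
    -- Two unshuffles in the same coset differ by a block permutation; both are monotone on each
    -- block, so uniqueness of the sorted tuple makes them equal.
    have key : u' = u * blockPerm (τ * τ'⁻¹) (ρ * ρ'⁻¹) := by
      rw [blockPerm_mul, ← mul_assoc, h, mul_assoc, ← blockPerm_mul, mul_inv_cancel,
        mul_inv_cancel, blockPerm_one, mul_one]
    have h1 : u' ∘ Fin.castAdd M = (u ∘ Fin.castAdd M) ∘ (τ * τ'⁻¹ : Equiv.Perm (Fin i)) := by
      funext r; simp [key]
    have h2 : u' ∘ Fin.natAdd i = (u ∘ Fin.natAdd i) ∘ (ρ * ρ'⁻¹ : Equiv.Perm (Fin M)) := by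
      funext r; simp [key]
    have h3 := Tuple.unique_monotone (f := u ∘ Fin.castAdd M) (σ := 1) (τ := τ * τ'⁻¹)
      hu.1 (h1 ▸ hu'.1)
    have h4 := Tuple.unique_monotone (f := u ∘ Fin.natAdd i) (σ := 1) (τ := ρ * ρ'⁻¹)
      hu.2 (h2 ▸ hu'.2)
    have huu : u = u' := by
      ext x
      refine Fin.addCases (fun r => ?_) (fun r => ?_) x
      · exact congrArg Fin.val ((congrFun h3 r).trans (congrFun h1 r).symm)
      · exact congrArg Fin.val ((congrFun h4 r).trans (congrFun h2 r).symm)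
    subst huu
    obtain ⟨rfl, rfl⟩ := blockPerm_injective (mul_left_cancel h)
    rfl
  · intro σ _
    -- Sorting the values of `σ` on each block produces the unshuffle.
    let τ := Tuple.sort (σ ∘ Fin.castAdd M)
    let ρ := Tuple.sort (σ ∘ Fin.natAdd i)
    refine ⟨(σ * blockPerm τ ρ, τ⁻¹, ρ⁻¹), ?_, ?_⟩
    · simp only [Finset.mem_product, Finset.mem_filter, Finset.mem_univ, true_and, and_true,
        isUnshuffle_iff]
      constructor
      · have := Tuple.monotone_sort (σ ∘ Fin.castAdd M)
        convert this using 1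
        funext r; simp [τ]
      · have := Tuple.monotone_sort (σ ∘ Fin.natAdd i)
        convert this using 1
        funext r; simp [ρ]
    · simp [mul_assoc, ← blockPerm_mul]

end Blocks

/-! ### Interchange of adjacent blocks -/

section BlockSwap

/-- The permutation `σ` with `(σ 0, σ 1, …) = (i, …, i + p - 1, 0, …, i - 1, i + p, …)`. -/
def blockSwap (n i p : ℕ) (h : i + p ≤ n) : Equiv.Perm (Fin n) where
  toFun q := ⟨if (q : ℕ) < p then i + q else if (q : ℕ) < p + i then q - p else q, by
    have := q.2; split_ifs <;> omega⟩
  invFun q := ⟨if (q : ℕ) < i then p + q else if (q : ℕ) < p + i then q - i else q, by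
    have := q.2; split_ifs <;> omega⟩
  left_inv q := by
    ext; have := q.2; dsimp only; split_ifs <;> omega
  right_inv q := by
    ext; have := q.2; dsimp only; split_ifs <;> omega

theorem blockSwap_val (n i p : ℕ) (h : i + p ≤ n) (q : Fin n) :
    (blockSwap n i p h q : ℕ) =
      if (q : ℕ) < p then i + q else if (q : ℕ) < p + i then (q : ℕ) - p else q := rfl

/-- The inversions are exactly the pairs of one element from each of the two exchanged blocks, so
the exponent factors as a product of two sums. -/
theorem permKoszulSign_blockSwap (n i p : ℕ) (h : i + p ≤ n) (w : Fin n → ℤ) :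
    permKoszulSign (blockSwap n i p h) w =
      ((∑ q ∈ Finset.range p, entry w (i + q)) *
        ∑ r ∈ Finset.range i, entry w r).negOnePow := by
  -- Indexed by the values `c`, `d` of the permutation instead of their positions.
  let G : Fin n → Fin n → ℤˣ := fun c d =>
    if (i ≤ (c : ℕ) ∧ (c : ℕ) < i + p) ∧ (d : ℕ) < i then (w c * w d).negOnePow else 1
  have h1 : permKoszulSign (blockSwap n i p h) w = ∏ c, ∏ d, G c d := by
    rw [← Equiv.prod_comp (blockSwap n i p h)]
    simp_rw [fun c => (Equiv.prod_comp (blockSwap n i p h) (G c)).symm]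
    refine Finset.prod_congr rfl fun a _ => Finset.prod_congr rfl fun b _ => ?_
    have ha := a.2
    have hb := b.2
    simp only [G]
    refine if_congr ?_ rfl rfl
    simp only [Fin.lt_def, blockSwap_val]
    split_ifs <;> omega
  rw [h1, Finset.sum_mul_sum, Int.negOnePow_sum]
  simp_rw [Int.negOnePow_sum]
  have h3 : ∀ c d, G c d = if (i ≤ (c : ℕ) ∧ (c : ℕ) < i + p) ∧ (d : ℕ) < i then
      (entry w c * entry w d).negOnePow else 1 := by
    intro c d; simp [G, entry]
  simp_rw [h3]
  simp_rw [fun c : ℕ => Fin.prod_univ_eq_prod_range (fun d =>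
    if (i ≤ c ∧ c < i + p) ∧ d < i then (entry w c * entry w d).negOnePow else 1) n]
  rw [Fin.prod_univ_eq_prod_range (fun c => ∏ d ∈ Finset.range n,
    if (i ≤ c ∧ c < i + p) ∧ d < i then (entry w c * entry w d).negOnePow else 1) n]
  simp_rw [ite_and, Finset.prod_ite_irrel, Finset.prod_const_one, ← ite_and]
  rw [← Finset.prod_filter, show (Finset.range n).filter (fun c => i ≤ c ∧ c < i + p) =
    Finset.Ico i (i + p) by ext c; simp; omega, Finset.prod_Ico_eq_prod_range,
    Nat.add_sub_cancel_left]
  refine Finset.prod_congr rfl fun q _ => ?_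
  rw [← Finset.prod_filter, show (Finset.range n).filter (fun d => d < i) = Finset.range i by
    ext c; simp; omega]

/-- Every permutation of `Fin (1 + M)` is uniquely determined by the place `p` of `0` and the
arrangement of the remaining elements. -/
theorem sum_perm_one_add {M : ℕ} {G : Type*} [AddCommMonoid G]
    (F : Equiv.Perm (Fin (1 + M)) → G) :
    ∑ σ, F σ = ∑ p : Fin (1 + M), ∑ ρ : Equiv.Perm (Fin M),
      F (blockPerm 1 ρ * blockSwap (1 + M) 1 p (by omega)) := by
  rw [← Finset.sum_product']
  have hval : ∀ p q : Fin (1 + M), ∀ h, (blockSwap (1 + M) 1 p h q : ℕ) = 0 ↔ q = p := by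
    intro p q h
    rw [blockSwap_val, Fin.ext_iff]
    split_ifs <;> omega
  have hbl : ∀ (ρ : Equiv.Perm (Fin M)) (x : Fin (1 + M)),
      (blockPerm 1 ρ x : ℕ) = 0 ↔ (x : ℕ) = 0 := by
    intro ρ x
    refine Fin.addCases (fun r => ?_) (fun r => ?_) x
    · simp
    · rw [blockPerm_natAdd]; simp
  let Φ : Fin (1 + M) × Equiv.Perm (Fin M) → Equiv.Perm (Fin (1 + M)) := fun q =>
    blockPerm 1 q.2 * blockSwap (1 + M) 1 q.1 (by omega)
  -- The place `p` is recovered as the preimage of `0`, since `blockPerm 1 ρ` fixes `0`.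
  have hinj : Function.Injective Φ := by
    rintro ⟨p, ρ⟩ ⟨p', ρ'⟩ h
    have hp : p = p' := by
      have h1 : (Φ (p, ρ) p : ℕ) = 0 := by
        simp only [Φ, Equiv.Perm.mul_apply]
        rw [hbl, hval]
      rw [h] at h1
      simp only [Φ, Equiv.Perm.mul_apply] at h1
      rwa [hbl, hval] at h1
    subst hp
    rw [show ρ = ρ' from (blockPerm_injective (mul_right_cancel h)).2]
  have hbij : Function.Bijective Φ := by
    -- Surjectivity by counting: `(1 + M) · M! = (1 + M)!`.
    rw [Fintype.bijective_iff_injective_and_card]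
    refine ⟨hinj, ?_⟩
    rw [Fintype.card_prod, Fintype.card_perm, Fintype.card_perm, Fintype.card_fin,
      Fintype.card_fin, Nat.add_comm 1 M, Nat.factorial_succ]
  exact (Fintype.sum_bijective Φ hbij _ _ fun _ => rfl).symm

end BlockSwap

/-! ### Signs and multilinear maps -/

section Antisymmetrization

variable {k V : Type*} [Field k] [AddCommGroup V] [Module k V]

/-- Turns signs into scalars of `k`, to which multilinearity applies. -/
theorem units_smul_eq_cast_smul (u : ℤˣ) (v : V) : u • v = ((u : ℤ) : k) • v := by
  rw [Units.smul_def, Int.cast_smul_eq_zsmul]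

theorem MultilinearMap.map_units_smul_univ {n : ℕ} (x : MultiMap k V n) (c : Fin n → ℤˣ)
    (a : Fin n → V) : x (fun i => c i • a i) = (∏ i, c i) • x a := by
  simp_rw [units_smul_eq_cast_smul (k := k)]
  rw [MultilinearMap.map_smul_univ]
  simp

theorem Submodule.units_smul_mem (W : Submodule k V) (u : ℤˣ) {v : V} (hv : v ∈ W) :
    u • v ∈ W := by
  rw [units_smul_eq_cast_smul (k := k)]
  exact W.smul_mem _ hv

theorem entry_of_lt {α : Type*} [Zero α] {n : ℕ} (a : Fin n → α) {p : ℕ} (h : p < n) :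
    entry a p = a ⟨p, h⟩ := dif_pos h

variable (𝒜 : ℤ → Submodule k V)

theorem HomogeneousTuple.comp {n m : ℕ} {e : Fin n → ℤ} {a : Fin n → V}
    (h : HomogeneousTuple 𝒜 e a) (f : Fin m → Fin n) : HomogeneousTuple 𝒜 (e ∘ f) (a ∘ f) :=
  fun i => h (f i)

variable [DirectSum.Decomposition 𝒜]

theorem shiftSign_pow_of_mem {i : ℤ} {v : V} (hv : v ∈ 𝒜 i) (r : ℕ) :
    (shiftSign 𝒜 ^ r) v = (i - 1).negOnePow ^ r • v := by
  induction r with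
  | zero => simp
  | succ r ih =>
    rw [pow_succ', Module.End.mul_apply, ih, Units.smul_def, map_zsmul, shiftSign_of_mem 𝒜 hv,
      ← Units.smul_def, smul_smul, pow_succ]

theorem tildeMap_apply {n : ℕ} (x : MultiMap k V n) {e : Fin n → ℤ} {a : Fin n → V}
    (ha : HomogeneousTuple 𝒜 e a) :
    tildeMap 𝒜 x a = tildeSign (fun i => e i - 1) • x a := by
  rw [tildeMap, MultilinearMap.compLinearMap_apply, tildeSign,
    ← MultilinearMap.map_units_smul_univ]
  congr 1
  funext i
  exact shiftSign_pow_of_mem 𝒜 (ha i) _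

/-- Graded antisymmetrization of `x` is graded symmetrization of `x̃` for the shifted degrees. -/
theorem gradedAntisymm_eq_tilde {n : ℕ} (x : MultiMap k V n) {e : Fin n → ℤ} {a : Fin n → V}
    (ha : HomogeneousTuple 𝒜 e a) :
    gradedAntisymm 𝒜 x a = tildeSign (fun i => e i - 1) •
      ∑ σ, permKoszulSign σ (fun i => e i - 1) • tildeMap 𝒜 x (a ∘ σ) := by
  rw [gradedAntisymm_apply 𝒜 x e a ha, Finset.smul_sum]
  refine Finset.sum_congr rfl fun σ _ => ?_
  rw [tildeMap_apply 𝒜 x (ha.comp 𝒜 σ), smul_smul, smul_smul, mul_assoc]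
  congr 1
  have := antiKoszulSign_mul_tildeSign σ e
  simp only [Function.comp_apply]
  rw [← this, mul_comm, mul_assoc, tildeSign_mul_self, mul_one]

theorem gradedAntisymm_isGradedAntisymm {n : ℕ} (x : MultiMap k V n) :
    IsGradedAntisymm 𝒜 (gradedAntisymm 𝒜 x) := by
  intro σ e a ha
  rw [gradedAntisymm_apply 𝒜 x _ _ (ha.comp 𝒜 σ), gradedAntisymm_apply 𝒜 x e a ha,
    Finset.smul_sum]
  -- Reindexing by left multiplication with `σ`; the cocycle rule then pulls out the sign of `σ`.
  refine Eq.trans ?_ (Equiv.sum_comp (Equiv.mulLeft σ) _)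
  refine Finset.sum_congr rfl fun τ _ => ?_
  rw [Equiv.coe_mulLeft, antiKoszulSign_mul, smul_smul, ← mul_assoc, Int.units_mul_self, one_mul]
  rfl

theorem gradedAntisymm_hasSuperDegree {n : ℕ} (x : MultiMap k V n) {s : ℤ}
    (hx : HasSuperDegree 𝒜 x s) : HasSuperDegree 𝒜 (gradedAntisymm 𝒜 x) s := by
  intro e a ha
  rw [gradedAntisymm_apply 𝒜 x e a ha]
  refine Submodule.sum_mem _ fun σ _ => Submodule.units_smul_mem _ _ ?_
  have := hx _ _ (ha.comp 𝒜 σ)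
  rwa [show ∑ i, (e ∘ σ) i = ∑ i, e i from Equiv.sum_comp σ e] at this

/-! ### Inserting an element into a word -/

/-- The word `(B₁, …, B_p, Y, B_{p+1}, …)`. -/
def insertEntry {M N : ℕ} (p : ℕ) (Y : V) (B : Fin M → V) : Fin N → V := fun q =>
  if (q : ℕ) < p then entry B q else if (q : ℕ) = p then Y else entry B (q - 1)

theorem insertEntry_eq_update {M N : ℕ} (p : Fin N) (Y : V) (B : Fin M → V) :
    insertEntry (N := N) p Y B = Function.update (insertEntry (p : ℕ) 0 B) p Y := by
  funext q
  by_cases h : q = p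
  · subst h; simp [insertEntry]
  · have : (q : ℕ) ≠ p := fun h' => h (Fin.ext h')
    simp [insertEntry, h, this]

theorem map_insertEntry_sum {M N : ℕ} {ι : Type*} (s : Finset ι) (x : MultiMap k V N) (p : Fin N)
    (B : Fin M → V) (c : ι → ℤˣ) (Y : ι → V) :
    x (insertEntry p (∑ t ∈ s, c t • Y t) B) = ∑ t ∈ s, c t • x (insertEntry p (Y t) B) := by
  rw [insertEntry_eq_update, MultilinearMap.map_update_sum]
  refine Finset.sum_congr rfl fun t _ => ?_
  rw [units_smul_eq_cast_smul (k := k), MultilinearMap.map_update_smul,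
    ← units_smul_eq_cast_smul, ← insertEntry_eq_update]

theorem map_insertEntry_units_smul {M N : ℕ} (x : MultiMap k V N) (p : Fin N)
    (B : Fin M → V) (c : ℤˣ) (Y : V) :
    x (insertEntry p (c • Y) B) = c • x (insertEntry p Y B) := by
  simpa using map_insertEntry_sum {()} x p B (fun _ => c) (fun _ => Y)

theorem append_comp_blockPerm_mul_blockSwap {α : Type*} [Zero α] {M : ℕ} (Y : α) (B : Fin M → α)
    (ρ : Equiv.Perm (Fin M)) (p : ℕ) (h : 1 + p ≤ 1 + M) (q : Fin (1 + M)) :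
    Fin.append (fun _ : Fin 1 => Y) B ((blockPerm 1 ρ * blockSwap (1 + M) 1 p h : Equiv.Perm _) q) =
      if (q : ℕ) < p then entry (B ∘ ρ) q else if (q : ℕ) = p then Y
        else entry (B ∘ ρ) (q - 1) := by
  have hq := q.2
  rw [Equiv.Perm.mul_apply]
  split_ifs with h1 h2
  · have : blockSwap (1 + M) 1 p h q = Fin.natAdd 1 ⟨q, by omega⟩ := by
      ext; rw [blockSwap_val, if_pos h1]; rfl
    rw [this, blockPerm_natAdd, Fin.append_right, entry_of_lt _ (by omega)]
    rfl
  · have : blockSwap (1 + M) 1 p h q = Fin.castAdd M 0 := by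
      ext; rw [blockSwap_val, if_neg h1, if_pos (by omega)]; simp; omega
    rw [this, blockPerm_castAdd, Fin.append_left]
  · have : blockSwap (1 + M) 1 p h q = Fin.natAdd 1 ⟨q - 1, by omega⟩ := by
      ext; rw [blockSwap_val, if_neg h1, if_neg (by omega)]; simp; omega
    rw [this, blockPerm_natAdd, Fin.append_right, entry_of_lt _ (by omega)]
    rfl

/-- The graded symmetrization of `X` on `(Y, B₁, …, B_M)`, sorted by the place of `Y`. -/
theorem sum_perm_append {M : ℕ} (X : MultiMap k V (1 + M)) (Y : V) (B : Fin M → V) (y : ℤ)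
    (v : Fin M → ℤ) :
    ∑ ρ, permKoszulSign ρ (Fin.append (fun _ : Fin 1 => y) v) •
        X (Fin.append (fun _ : Fin 1 => Y) B ∘ ρ) =
      ∑ p : Fin (1 + M), ∑ ρ : Equiv.Perm (Fin M),
        (permKoszulSign ρ v * (y * ∑ q ∈ Finset.range p, entry (v ∘ ρ) q).negOnePow) •
          X (insertEntry p Y (B ∘ ρ)) := by
  rw [sum_perm_one_add]
  refine Finset.sum_congr rfl fun p _ => Finset.sum_congr rfl fun ρ _ => ?_
  congr 1
  · rw [permKoszulSign_mul, permKoszulSign_blockPerm, permKoszulSign_one, one_mul,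
      permKoszulSign_blockSwap]
    congr 1
    · congr 1
      funext r
      simp
    · rw [mul_comm y]
      congr 2
      · refine Finset.sum_congr rfl fun q hq => ?_
        have hq' : q < M := by have := Finset.mem_range.1 hq; omega
        rw [entry_of_lt _ (show 1 + q < 1 + M by omega), entry_of_lt _ hq',
          show (⟨1 + q, by omega⟩ : Fin (1 + M)) = Fin.natAdd 1 ⟨q, hq'⟩ from rfl,
          Function.comp_apply, blockPerm_natAdd, Fin.append_right, Function.comp_apply]
      · rw [Finset.sum_range_one, entry_of_lt _ (show 0 < 1 + M by omega),
          show (⟨0, by omega⟩ : Fin (1 + M)) = Fin.castAdd M 0 from rfl]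
        simp
  · congr 1
    funext q
    exact append_comp_blockPerm_mul_blockSwap Y B ρ p _ q

theorem append_eq_insertEntry {M : ℕ} (Y : V) (B : Fin M → V) :
    Fin.append (fun _ : Fin 1 => Y) B = insertEntry ((0 : Fin (1 + M)) : ℕ) Y B := by
  have := append_comp_blockPerm_mul_blockSwap Y B 1 0 (by omega)
  funext q
  have h := this q
  have h0 : blockSwap (1 + M) 1 0 (by omega) = 1 := by
    ext r; rw [blockSwap_val]; simp
  rw [h0, mul_one, blockPerm_one, Equiv.Perm.one_apply] at h
  exact h

/-! ### Antisymmetrized compositions -/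

theorem entry_comp_mul_blockSwap {α : Type*} [Zero α] {i M p : ℕ} (f : Fin (i + M) → α)
    (σ : Equiv.Perm (Fin (i + M))) (h : i + p ≤ i + M) (q : ℕ) (hq : q < p) :
    entry (f ∘ ⇑(σ * blockSwap (i + M) i p h)) q = entry (f ∘ σ ∘ Fin.natAdd i) q := by
  rw [entry_of_lt _ (by omega : q < i + M), entry_of_lt _ (by omega : q < M)]
  simp only [Function.comp_apply, Equiv.Perm.mul_apply]
  congr 2
  ext
  rw [blockSwap_val, if_pos hq]
  rfl

open Classical in
/-- The sum over unshuffles of compositions of graded symmetrizations is the graded symmetrization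
of the composition. -/
theorem sum_unshuffle_symm_comp {i M : ℕ} (X : MultiMap k V (1 + M)) (Y : MultiMap k V i) (s : ℤ)
    (ny : ℤ) (hs : (ny - (s + i - 1)) % 2 = 0)
    (e : Fin (i + M) → ℤ) (a : Fin (i + M) → V) :
    ∑ u : Equiv.Perm (Fin (i + M)) with IsUnshuffle i u,
      permKoszulSign u (fun t => e t - 1) •
        ∑ ρ, permKoszulSign ρ (Fin.append
            (fun _ : Fin 1 => ∑ r, e (u (Fin.castAdd M r)) + s - 1)
            (fun t => e (u (Fin.natAdd i t)) - 1)) •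
          X (Fin.append (fun _ : Fin 1 => ∑ τ, permKoszulSign τ
              (fun r => e (u (Fin.castAdd M r)) - 1) • Y (a ∘ u ∘ Fin.castAdd M ∘ τ))
            (a ∘ u ∘ Fin.natAdd i) ∘ ρ) =
      ∑ σ, permKoszulSign σ (fun t => e t - 1) • braceAt X Y ny (e ∘ σ) (a ∘ σ) := by
  let w : Fin (i + M) → ℤ := fun t => e t - 1
  let yw : Equiv.Perm (Fin (i + M)) → ℤ := fun σ => ∑ r, e (σ (Fin.castAdd M r)) + s - 1
  -- `F` has the arguments of `Y` in front, with the sign for carrying the value of `Y` past `p`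
  -- letters. `G` is the brace term, where these arguments already stand at place `p`.
  let F : Fin (1 + M) → Equiv.Perm (Fin (i + M)) → V := fun p σ =>
    (permKoszulSign σ w * (yw σ *
      ∑ q ∈ Finset.range p, entry (w ∘ σ ∘ Fin.natAdd i) q).negOnePow) •
        X (insertEntry p (Y (a ∘ σ ∘ Fin.castAdd M)) (a ∘ σ ∘ Fin.natAdd i))
  let G : Fin (1 + M) → Equiv.Perm (Fin (i + M)) → V := fun p σ =>
    (permKoszulSign σ w * (ny *
      ∑ q ∈ Finset.range p, (entry (e ∘ σ) q - 1)).negOnePow) •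
        X fun q => if (q : ℕ) < p then entry (a ∘ σ) q
          else if (q : ℕ) = p then Y fun r : Fin i => entry (a ∘ σ) (p + r)
          else entry (a ∘ σ) (q + i - 1)
  have hFG : ∀ p σ, F p σ = G p (σ * blockSwap (i + M) i p (by omega)) := by
    intro p σ
    have hp := p.2
    have hbe := entry_comp_mul_blockSwap e σ (show i + p ≤ i + M by omega)
    have hbV := entry_comp_mul_blockSwap a σ (show i + p ≤ i + M by omega)
    have hw : ∀ q < (p : ℕ), entry (e ∘ ⇑(σ * blockSwap (i + M) i p (by omega))) q - 1 =
        entry (w ∘ σ ∘ Fin.natAdd i) q := by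
      intro q hq
      rw [hbe q hq, entry_of_lt _ (by omega : q < M), entry_of_lt _ (by omega : q < M)]
      rfl
    simp only [F, G]
    congr 1
    · rw [permKoszulSign_mul, mul_assoc, permKoszulSign_blockSwap, ← Int.negOnePow_add]
      congr 1
      have e1 : ∑ q ∈ Finset.range p, entry (w ∘ σ) (i + q) =
          ∑ q ∈ Finset.range p, entry (w ∘ σ ∘ Fin.natAdd i) q := by
        refine Finset.sum_congr rfl fun q hq => ?_
        have hq' : q < M := by have := Finset.mem_range.1 hq; omega
        rw [entry_of_lt _ (show i + q < i + M by omega), entry_of_lt _ hq']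
        rfl
      -- The value of `Y` has shifted degree equal to that of its argument block plus `s + i - 1`.
      -- The block part gives the Koszul sign of `blockSwap`; the rest is `ny` modulo 2 and gives
      -- the sign of the brace.
      have e2 : ∑ r ∈ Finset.range i, entry (w ∘ σ) r + i = ∑ r, e (σ (Fin.castAdd M r)) := by
        rw [Finset.sum_range]
        have : ∀ r : Fin i, entry (w ∘ σ) r = e (σ (Fin.castAdd M r)) - 1 := fun r => by
          rw [entry_of_lt _ (by omega : (r : ℕ) < i + M)]; rfl
        simp [this]
      rw [e1, Finset.sum_congr rfl fun q hq => hw q (Finset.mem_range.1 hq)]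
      simp only [yw]
      rw [← e2, Int.negOnePow_eq_iff]
      obtain ⟨c, hc⟩ := Int.dvd_of_emod_eq_zero hs
      set S := ∑ q ∈ Finset.range p, entry (w ∘ σ ∘ Fin.natAdd i) q
      set R := ∑ r ∈ Finset.range i, entry (w ∘ σ) r
      refine ⟨-(c * S), ?_⟩
      linear_combination -S * hc
    · congr 1
      funext q
      have hq := q.2
      simp only [insertEntry]
      split_ifs with h1 h2
      · exact (hbV q h1).symm
      · congr 1
        funext r
        rw [entry_of_lt _ (by omega : (p : ℕ) + r < i + M)]
        simp only [Function.comp_apply, Equiv.Perm.mul_apply]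
        congr 2
        ext
        rw [blockSwap_val, if_neg (by simp), if_pos (by simp)]
        simp
      · rw [entry_of_lt _ (by omega : (q : ℕ) - 1 < M),
          entry_of_lt _ (by omega : (q : ℕ) + i - 1 < i + M)]
        simp only [Function.comp_apply, Equiv.Perm.mul_apply]
        congr 2
        ext
        rw [blockSwap_val, if_neg (by simp; omega), if_neg (by simp; omega)]
        simp; omega
  have hR : ∑ σ, permKoszulSign σ w • braceAt X Y ny (e ∘ σ) (a ∘ σ) = ∑ p, ∑ σ, G p σ := by
    rw [Finset.sum_comm]
    refine Finset.sum_congr rfl fun σ _ => ?_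
    rw [braceAt, Finset.sum_range, Finset.smul_sum]
    refine Finset.sum_congr rfl fun p _ => ?_
    rw [smul_smul]
  have hL : ∀ u : Equiv.Perm (Fin (i + M)), permKoszulSign u w •
        ∑ ρ, permKoszulSign ρ (Fin.append
            (fun _ : Fin 1 => ∑ r, e (u (Fin.castAdd M r)) + s - 1)
            (fun t => e (u (Fin.natAdd i t)) - 1)) •
          X (Fin.append (fun _ : Fin 1 => ∑ τ, permKoszulSign τ
              (fun r => e (u (Fin.castAdd M r)) - 1) • Y (a ∘ u ∘ Fin.castAdd M ∘ τ))
            (a ∘ u ∘ Fin.natAdd i) ∘ ρ) =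
      ∑ p, ∑ τ, ∑ ρ, F p (u * blockPerm τ ρ) := by
    intro u
    rw [sum_perm_append, Finset.smul_sum]
    refine Finset.sum_congr rfl fun p _ => ?_
    rw [Finset.sum_comm, Finset.smul_sum]
    refine Finset.sum_congr rfl fun ρ _ => ?_
    rw [map_insertEntry_sum, Finset.smul_sum, Finset.smul_sum]
    refine Finset.sum_congr rfl fun τ _ => ?_
    rw [smul_smul, smul_smul]
    simp only [F]
    have e1 : (fun r => u (blockPerm τ ρ (Fin.castAdd M r))) = fun r => u (Fin.castAdd M (τ r)) := by
      simp
    have e2 : ⇑(u * blockPerm τ ρ) ∘ Fin.castAdd M = u ∘ Fin.castAdd M ∘ τ := by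
      funext r; simp
    have e3 : ⇑(u * blockPerm τ ρ) ∘ Fin.natAdd i = u ∘ Fin.natAdd i ∘ ρ := by
      funext r; simp
    have e4 : yw (u * blockPerm τ ρ) = ∑ r, e (u (Fin.castAdd M r)) + s - 1 := by
      simp only [yw, Equiv.Perm.mul_apply, blockPerm_castAdd]
      rw [Equiv.sum_comp τ (fun r => e (u (Fin.castAdd M r)))]
    rw [e2, e3, e4]
    congr 1
    rw [permKoszulSign_mul, permKoszulSign_blockPerm]
    have e5 : (fun t => e (u (Fin.natAdd i t)) - 1) ∘ ρ = w ∘ u ∘ Fin.natAdd i ∘ ρ := rfl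
    have e6 : (w ∘ u) ∘ Fin.castAdd M = fun r => e (u (Fin.castAdd M r)) - 1 := rfl
    have e7 : (w ∘ u) ∘ Fin.natAdd i = fun r => e (u (Fin.natAdd i r)) - 1 := rfl
    rw [e5, e6, e7]
    simp only [mul_assoc, mul_left_comm, mul_comm]
  change _ = ∑ σ, permKoszulSign σ w • braceAt X Y ny (e ∘ σ) (a ∘ σ)
  rw [hR, Finset.sum_congr rfl fun u _ => hL u, Finset.sum_comm]
  refine Finset.sum_congr rfl fun p _ => ?_
  rw [sum_unshuffle_blockPerm (F p)]
  -- For fixed `p`, right multiplication by `blockSwap` only reindexes the sum over `σ`.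
  simp_rw [hFG]
  exact Equiv.sum_comp (Equiv.mulRight (blockSwap (i + M) i p (by omega))) (G p)

/-- A letter of the inner block has exponent `M` larger in the full word than in the block alone.
This excess cancels against the inserted value, which stands before `M` letters, except for the
extra `1` in its degree; that leaves `(-1)^M`. -/
theorem tildeSign_append {i M : ℕ} (w : Fin (i + M) → ℤ) (y : ℤ)
    (hy : (y - (∑ r, w (Fin.castAdd M r) + 1)) % 2 = 0) :
    tildeSign w * (tildeSign (Fin.append (fun _ : Fin 1 => y) (w ∘ Fin.natAdd i)) *
      tildeSign (w ∘ Fin.castAdd M)) = (M : ℤ).negOnePow := by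
  have hy' : y.negOnePow = -∏ r, (w (Fin.castAdd M r)).negOnePow := by
    rw [← Int.negOnePow_sum, ← Int.negOnePow_succ, Int.negOnePow_eq_iff]
    exact Int.even_iff.2 hy
  have h1 : ∏ r : Fin i, (w (Fin.castAdd M r)).negOnePow ^ (i + M - 1 - (r : ℕ)) =
      (∏ r : Fin i, (w (Fin.castAdd M r)).negOnePow ^ (i - 1 - (r : ℕ))) *
        (∏ r, (w (Fin.castAdd M r)).negOnePow) ^ M := by
    rw [← Finset.prod_pow, ← Finset.prod_mul_distrib]
    refine Finset.prod_congr rfl fun r _ => ?_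
    rw [← pow_add]
    congr 1
    omega
  have h2 : ∀ t : Fin M, i + M - 1 - (i + (t : ℕ)) = M - 1 - t := fun t => by omega
  have h3 : ∀ t : Fin M, 1 + M - 1 - (1 + (t : ℕ)) = M - 1 - t := fun t => by omega
  simp only [tildeSign, Fin.prod_univ_add, Fin.val_castAdd, Fin.val_natAdd, Fin.append_left,
    Fin.append_right, Function.comp_apply, h1, h2, h3, hy', Finset.univ_unique,
    Finset.prod_singleton, Fin.default_eq_zero, Fin.val_zero]
  rw [show 1 + M - 1 - 0 = M by omega, Int.negOnePow_def, zpow_natCast, neg_pow]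
  generalize (∏ r, (w (Fin.castAdd M r)).negOnePow) ^ M = P
  generalize (∏ r : Fin i, (w (Fin.castAdd M r)).negOnePow ^ (i - 1 - (r : ℕ))) = C
  generalize (∏ t : Fin M, (w (Fin.natAdd i t)).negOnePow ^ (M - 1 - (t : ℕ))) = K
  calc C * P * K * ((-1) ^ M * P * K * C) = (-1) ^ M * (C * C) * (P * P) * (K * K) := by
        simp only [mul_assoc, mul_left_comm, mul_comm]
    _ = (-1) ^ M := by simp only [Int.units_mul_self, mul_one]

-- Both antisymmetrizations are rewritten through tilde maps, reducing to `sum_unshuffle_symm_comp`;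
-- the three tilde signs collapse by `tildeSign_append`.
open Classical in
theorem sum_unshuffle_gradedAntisymm {n i j : ℕ} (hij : i + j = n + 1) (hj : 1 ≤ j)
    (x : MultiMap k V j) (y : MultiMap k V i) {s : ℤ} (hs : s ≡ i [ZMOD 2])
    (hy : HasSuperDegree 𝒜 y s) (e : Fin n → ℤ) (a : Fin n → V) (ha : HomogeneousTuple 𝒜 e a) :
    ∑ σ : Equiv.Perm (Fin n) with IsUnshuffle i σ, antiKoszulSign σ e •
        gradedAntisymm 𝒜 x (fun q : Fin j =>
          if (q : ℕ) = 0 then gradedAntisymm 𝒜 y fun r : Fin i => entry (a ∘ σ) r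
          else entry (a ∘ σ) (q + i - 1)) =
      ((j : ℤ) - 1).negOnePow • tildeSign (fun t => e t - 1) •
        ∑ σ, permKoszulSign σ (fun t => e t - 1) •
          braceAt (tildeMap 𝒜 x) (tildeMap 𝒜 y) ((i : ℤ) - 1 + i) (e ∘ σ) (a ∘ σ) := by
  obtain ⟨M, rfl⟩ : ∃ M, j = 1 + M := ⟨j - 1, by omega⟩
  obtain rfl : n = i + M := by omega
  have hs' : (s - i) % 2 = 0 := by
    have := hs; unfold Int.ModEq at this; omega
  rw [← sum_unshuffle_symm_comp (tildeMap 𝒜 x) (tildeMap 𝒜 y) s ((i : ℤ) - 1 + i) (by omega)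
    e a, Finset.smul_sum, Finset.smul_sum]
  refine Finset.sum_congr rfl fun u _ => ?_
  have h1 : (fun r : Fin i => entry (a ∘ u) r) = a ∘ u ∘ Fin.castAdd M := by
    funext r
    rw [entry_of_lt _ (by omega : (r : ℕ) < i + M)]; rfl
  have h2 : ∀ Z : V, (fun q : Fin (1 + M) => if (q : ℕ) = 0 then Z
      else entry (a ∘ u) (q + i - 1)) =
      insertEntry ((0 : Fin (1 + M)) : ℕ) Z (a ∘ u ∘ Fin.natAdd i) := by
    intro Z
    funext q
    have hq := q.2
    have h0 : ((0 : Fin (1 + M)) : ℕ) = 0 := rfl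
    simp only [insertEntry, h0, Nat.not_lt_zero, if_false]
    split_ifs with h
    · rfl
    · rw [entry_of_lt _ (by omega : (q : ℕ) + i - 1 < i + M),
        entry_of_lt _ (by omega : (q : ℕ) - 1 < M)]
      simp only [Function.comp_apply]
      congr 2
      ext
      simp; omega
  rw [h1, h2]
  have hc := ha.comp 𝒜 (u ∘ Fin.castAdd M)
  have hd := ha.comp 𝒜 (u ∘ Fin.natAdd i)
  rw [show a ∘ u ∘ Fin.castAdd M = a ∘ (⇑u ∘ Fin.castAdd M) from rfl,
    gradedAntisymm_eq_tilde 𝒜 y hc, map_insertEntry_units_smul, ← append_eq_insertEntry]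
  set Z : V := ∑ τ, permKoszulSign τ (fun r => (e ∘ u ∘ Fin.castAdd M) r - 1) •
    tildeMap 𝒜 y ((a ∘ ⇑u ∘ Fin.castAdd M) ∘ τ) with hZ
  -- Homogeneity of the inner value is needed to apply `gradedAntisymm_eq_tilde` to the outer map.
  have hZmem : Z ∈ 𝒜 (∑ r, e (u (Fin.castAdd M r)) + s) := by
    refine Submodule.sum_mem _ fun τ _ => Submodule.units_smul_mem _ _ ?_
    rw [tildeMap_apply 𝒜 y (hc.comp 𝒜 τ)]
    refine Submodule.units_smul_mem _ _ ?_
    have := hy _ _ (hc.comp 𝒜 τ)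
    rwa [show ∑ r, ((e ∘ ⇑u ∘ Fin.castAdd M) ∘ τ) r = ∑ r, e (u (Fin.castAdd M r)) from
      Equiv.sum_comp τ (e ∘ ⇑u ∘ Fin.castAdd M)] at this
  have hhom : HomogeneousTuple 𝒜
      (Fin.append (fun _ : Fin 1 => ∑ r, e (u (Fin.castAdd M r)) + s) (e ∘ u ∘ Fin.natAdd i))
      (Fin.append (fun _ : Fin 1 => Z) (a ∘ u ∘ Fin.natAdd i)) := by
    intro q
    refine Fin.addCases (fun r => ?_) (fun r => ?_) q
    · simpa using hZmem
    · simpa using hd r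
  have happ : (fun q => Fin.append (fun _ : Fin 1 => ∑ r, e (u (Fin.castAdd M r)) + s)
      (e ∘ u ∘ Fin.natAdd i) q - 1) =
      Fin.append (fun _ : Fin 1 => ∑ r, e (u (Fin.castAdd M r)) + s - 1)
        (fun t => e (u (Fin.natAdd i t)) - 1) := by
    funext q
    refine Fin.addCases (fun r => ?_) (fun r => ?_) q <;> simp
  rw [gradedAntisymm_eq_tilde 𝒜 x hhom, happ]
  simp only [smul_smul]
  congr 1
  have hA : antiKoszulSign u e = tildeSign (fun t => e t - 1) *
      (permKoszulSign u (fun t => e t - 1) * tildeSign (fun t => e (u t) - 1)) := by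
    rw [← antiKoszulSign_mul_tildeSign, mul_left_comm, tildeSign_mul_self, mul_one]
  have hT := tildeSign_append (fun t => e (u t) - 1)
    (∑ r, e (u (Fin.castAdd M r)) + s - 1) (by simp; omega)
  rw [hA, show (((1 + M : ℕ) : ℤ) - 1) = M by push_cast; ring, ← hT]
  have e1 : (fun t => e (u t) - 1) ∘ Fin.natAdd i = fun t => e (u (Fin.natAdd i t)) - 1 := rfl
  have e2 : (fun t => e (u t) - 1) ∘ Fin.castAdd M =
    fun r => (e ∘ ⇑u ∘ Fin.castAdd M) r - 1 := rfl
  rw [e1, e2]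
  simp only [mul_assoc, mul_left_comm, mul_comm]

-- With `j = n + 1 - i` the signs `(-1)^i` and `(-1)^(j-1)` multiply to `(-1)^n`, so summing over
-- `i` yields the `A∞` relation at each permuted tuple.
open Classical in
theorem lInftyRelation_gradedAntisymm (m : (n : ℕ) → MultiMap k V n)
    (hm : ∀ n : ℕ, 1 ≤ n → ∃ s : ℤ, s ≡ (n : ℤ) [ZMOD 2] ∧ HasSuperDegree 𝒜 (m n) s) (n : ℕ)
    (h : AInftyRelation 𝒜 m n) : LInftyRelation 𝒜 (fun n => gradedAntisymm 𝒜 (m n)) n := by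
  intro e a ha
  have key : ∀ i ∈ Finset.Icc 1 n, (i : ℤ).negOnePow •
      ∑ σ : Equiv.Perm (Fin n) with IsUnshuffle i σ, antiKoszulSign σ e •
        gradedAntisymm 𝒜 (m (n + 1 - i)) (fun q : Fin (n + 1 - i) =>
          if (q : ℕ) = 0 then gradedAntisymm 𝒜 (m i) fun r : Fin i => entry (a ∘ σ) r
          else entry (a ∘ σ) (q + i - 1)) =
      ((n : ℤ).negOnePow * tildeSign (fun t => e t - 1)) •
        ∑ σ, permKoszulSign σ (fun t => e t - 1) •
          braceAt (tildeMap 𝒜 (m (n + 1 - i))) (tildeMap 𝒜 (m i)) ((i : ℤ) - 1 + i)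
            (e ∘ σ) (a ∘ σ) := by
    intro i hi
    obtain ⟨h1, h2⟩ := Finset.mem_Icc.1 hi
    obtain ⟨s, hs, hy⟩ := hm i h1
    rw [sum_unshuffle_gradedAntisymm 𝒜 (by omega) (by omega) (m (n + 1 - i)) (m i) hs hy e a ha,
      smul_smul, smul_smul, ← Int.negOnePow_add, show (i : ℤ) + ((n + 1 - i : ℕ) - 1) = n by omega]
  rw [Finset.sum_congr rfl key, ← Finset.smul_sum, Finset.sum_comm]
  simp_rw [← Finset.smul_sum]
  rw [Finset.sum_eq_zero, smul_zero]
  intro σ _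
  rw [h _ _ (ha.comp 𝒜 σ), smul_zero]

end Antisymmetrization

/-! ### The one-slot part of the master identity -/

namespace OrderedPartition

theorem exists_eq_single {τ : OrderedPartition} (h : τ.1.length = 1) : ∃ n, τ = single n := by
  obtain ⟨n, hn⟩ := List.length_eq_one_iff.1 h
  exact ⟨n, Subtype.ext hn⟩

theorem single_injective : Function.Injective single := fun i j h => by
  simpa [single] using congrArg Subtype.val h

theorem not_regular_single_zero : ¬ (single 0).Regular := fun h => by
  simpa using h 0 (by simp [single])

theorem regular_single {n : ℕ} (hn : 1 ≤ n) : (single n).Regular := by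
  intro i hi
  simp only [single, List.mem_singleton] at hi
  omega

theorem single_ne_pair (n i j : ℕ) : single n ≠ pair i j := fun h => by
  simpa [single, pair] using congrArg Subtype.val h

theorem Occurs.length_eq_one_iff {π π' τ : OrderedPartition} (h : Occurs π π' τ) :
    τ.1.length = 1 ↔ π.1.length = 1 ∧ π'.1.length = 1 := by
  obtain ⟨l, hl⟩ := h
  have h0 := hl.length_sum.1
  have h1 : 1 ≤ π.1.length := List.length_pos_iff.2 π.2
  have h2 : 1 ≤ π'.1.length := List.length_pos_iff.2 π'.2
  omega

/-- The replaced slot cannot be zero, which excludes `i = n + 1`. -/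
theorem Occurs.eq_single {π π' : OrderedPartition} {n : ℕ} (h : Occurs π π' (single n)) :
    ∃ i ≤ n, π = single (n + 1 - i) ∧ π' = single i := by
  obtain ⟨h1, h2⟩ := h.length_eq_one_iff.1 rfl
  obtain ⟨j, rfl⟩ := exists_eq_single h1
  obtain ⟨i, rfl⟩ := exists_eq_single h2
  obtain ⟨l, hl, ρ, hρ, hτ⟩ := h
  obtain rfl : l = 0 := by simpa [single] using hl
  obtain rfl : ρ = [n] := by simpa [single] using hτ.symm
  have h3 := hρ.sum_eq
  obtain ⟨u, hu, hs, -⟩ := hρ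
  simp only [single, List.getD_cons_zero, List.sum_singleton] at h3 hs
  exact ⟨i, by omega, congrArg single (by omega), rfl⟩

theorem occursAt_single {i j n : ℕ} (hij : i + j = n + 1) (hj : 1 ≤ j) :
    OccursAt (single j) (single i) (single n) 0 :=
  ⟨by simp [single], [n], ⟨[n - i], by simp [single], by simp [single]; omega,
    by simp [single]; omega⟩, by simp [single]⟩

theorem single_d (n : ℕ) : (single n).d = n - 1 := by simp [d, single]

theorem single_superParity (n : ℕ) : (single n).superParity = n := by
  rw [superParity, single_d, dBar]; simp [single]

end OrderedPartition

/-! ### Signs and lengths of shuffled words. -/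

theorem wordSign_of_pairwise_lt (w : ℕ → ℤ) {L : List ℕ} (h : L.Pairwise (· < ·)) :
    wordSign w L = 1 := by
  induction L with
  | nil => rfl
  | cons p L ih =>
    rw [List.pairwise_cons] at h
    have : L.filter (· < p) = [] := by
      rw [List.filter_eq_nil_iff]
      intro q hq
      simpa using (h.1 q hq).le
    rw [wordSign, this, ih h.2]
    simp

theorem interleave_nil_right (xs : List ℕ) : interleave xs [] = [xs] := by
  cases xs <;> simp [interleave]

theorem List.sum_map_range {G : Type*} [AddCommMonoid G] (f : ℕ → G) (n : ℕ) :
    ((List.range n).map f).sum = ∑ p ∈ Finset.range n, f p := by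
  induction n with
  | zero => rfl
  | succ n ih => rw [List.sum_range_succ, Finset.sum_range_succ, ih]

theorem shuffles_singleton (b : List ℕ) : shuffles [b] = [b] := by
  simp [shuffles, interleave_nil_right]

theorem length_of_mem_interleave {xs ys β : List ℕ} (h : β ∈ interleave xs ys) :
    β.length = xs.length + ys.length := by
  induction xs, ys using interleave.induct generalizing β with
  | case1 ys => simp_all [interleave]
  | case2 xs _ => simp_all [interleave_nil_right]
  | case3 x xs y ys ih1 ih2 =>
    rw [interleave, List.mem_append, List.mem_map, List.mem_map] at h
    rcases h with ⟨γ, hγ, rfl⟩ | ⟨γ, hγ, rfl⟩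
    · have := ih1 hγ
      simp only [List.length_cons] at *
      omega
    · have := ih2 hγ
      simp only [List.length_cons] at *
      omega

theorem length_of_mem_shuffles {ws : List (List ℕ)} {β : List ℕ} (h : β ∈ shuffles ws) :
    β.length = (ws.map List.length).sum := by
  induction ws generalizing β with
  | nil => simp_all [shuffles]
  | cons w ws ih =>
    rw [shuffles, List.mem_flatMap] at h
    obtain ⟨γ, hγ, hβ⟩ := h
    rw [length_of_mem_interleave hβ, ih hγ]
    simp

theorem map_length_slotWords (o : ℕ) (ks : List ℕ) : (slotWords o ks).map List.length = ks := by
  induction ks generalizing o with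
  | nil => rfl
  | cons c ks ih => simp [slotWords, ih]

/-- The words `b⁽ʰ⁾` of a subdivision of words of lengths `j_h + u_h` have at most
`u₁ + ⋯ + u_s` letters. -/
theorem sum_length_le_of_mem_subdivisions {π' u : List ℕ} {ws : List (List ℕ)}
    {S : List (List ℕ × List ℕ × List ℕ)} (hu : u.length = π'.length)
    (hws : ws.map List.length = List.zipWith (· + ·) π' u) (hS : S ∈ subdivisions π' ws) :
    ((S.map fun t => t.1).map List.length).sum ≤ u.sum := by
  rw [subdivisions, List.mem_sections] at hS
  induction π' generalizing u ws S with
  | nil =>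
    obtain rfl : S = [] := by simpa using hS
    simp
  | cons j π' ih =>
    cases u with
    | nil => simp at hu
    | cons c u =>
      cases ws with
      | nil => simp at hws
      | cons w ws =>
        rw [List.zipWith_cons_cons, List.forall₂_cons_right_iff] at hS
        obtain ⟨t, S, ht, hS, rfl⟩ := hS
        simp only [List.map_cons, List.zipWith_cons_cons, List.cons.injEq] at hws
        have h := ih (by simpa using hu) hws.2 hS
        simp only [splittings, List.mem_map, List.mem_range] at ht
        obtain ⟨p, hp, rfl⟩ := ht
        simp only [List.map_cons, List.sum_cons, List.length_take]
        omega

/-! ### Compositions of one-slot maps. -/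

section MasterPart

variable {k V : Type*} [Field k] [AddCommGroup V] [Module k V]

open OrderedPartition

theorem composeAt_zero_left {π π' : OrderedPartition} (y : MultiMap k V π'.arity) (ny : ℤ)
    (τ : OrderedPartition) (e : Fin τ.arity → ℤ) (a : Fin τ.arity → V) :
    composeAt (0 : MultiMap k V π.arity) y ny τ e a = 0 := by
  refine Finset.sum_eq_zero fun l _ => ?_
  split_ifs
  · simp
  · rfl

/-- The inserted value is `0`, but arguments are read off a list with default values, so its
position must be shown to be a genuine argument of `x`. -/
theorem composeAt_zero_right {π π' : OrderedPartition} (x : MultiMap k V π.arity) (ny : ℤ)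
    (τ : OrderedPartition) (e : Fin τ.arity → ℤ) (a : Fin τ.arity → V) :
    composeAt x (0 : MultiMap k V π'.arity) ny τ e a = 0 := by
  refine Finset.sum_eq_zero fun l _ => ?_
  split_ifs with hocc
  swap
  · rfl
  refine List.sum_eq_zero fun v hv => ?_
  obtain ⟨S, hS, rfl⟩ := List.mem_map.1 hv
  refine List.sum_eq_zero fun v hv => ?_
  obtain ⟨β, hβ, rfl⟩ := List.mem_map.1 hv
  refine List.sum_eq_zero fun v hv => ?_
  obtain ⟨δ, hδ, rfl⟩ := List.mem_map.1 hv
  obtain ⟨hl, ρ, ⟨u, hu, hus, rfl⟩, hτ⟩ := hocc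
  have htake : τ.1.take l = π.1.take l := by
    rw [hτ, List.append_assoc, List.take_left' (by simp; omega)]
  have hws : (((slotWords 0 τ.1).drop l).take π'.1.length).map List.length =
      List.zipWith (· + ·) π'.1 u := by
    rw [List.map_take, List.map_drop, map_length_slotWords, hτ, List.append_assoc,
      List.drop_left' (by simp; omega), List.take_left' (by simp [hu])]
  have hsum : π.1.sum = (π.1.take l).sum + (π.1.getD l 0 + (π.1.drop (l + 1)).sum) := by
    conv_lhs => rw [← List.take_append_drop l π.1, List.sum_append,
      List.drop_eq_getElem_cons hl, List.sum_cons]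
    simp [List.getD_eq_getElem?_getD, hl]
  -- The letters of `β` number at most `i_l - 1`, leaving room for the inserted value in slot `l`.
  have hlen : (((slotWords 0 τ.1).take l).flatten ++ β).length < π.1.sum := by
    have h1 := sum_length_le_of_mem_subdivisions hu hws hS
    rw [List.length_append, length_of_mem_shuffles hβ, List.length_flatten, List.map_take,
      map_length_slotWords, htake]
    omega
  have hsmul : ∀ (c : ℤˣ) (v : V), v = 0 → c • v = 0 := by
    rintro c _ rfl
    exact smul_zero c
  refine hsmul _ _ (x.map_coord_zero ⟨_, hlen⟩ ?_)
  have hget : ∀ (L : List ℕ) (M : List V), (L.map (entry a) ++ [0] ++ M).getD L.length 0 = 0 :=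
    fun L M => by simp [List.getD_eq_getElem?_getD]
  exact hget _ _

theorem composeAt_single {i j n : ℕ} (hij : i + j = n + 1) (hj : 1 ≤ j)
    (x : MultiMap k V j) (y : MultiMap k V i) (ny : ℤ) (e : Fin n → ℤ) (a : Fin n → V) :
    composeAt (π := single j) (π' := single i) x y ny (single n) e a = braceAt x y ny e a := by
  unfold composeAt
  rw [show (single j).1.length = 1 from rfl, Finset.sum_range_one,
    if_pos (occursAt_single hij hj)]
  simp only [single, slotWords, List.take_zero, List.flatten_nil, List.drop_zero, List.length_cons,
    List.length_nil, zero_add, List.take_succ_cons, List.drop_succ_cons, List.drop_nil,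
    subdivisions, List.zipWith_cons_cons, List.zipWith_nil_left, List.sections]
  simp only [List.flatMap_cons, List.flatMap_nil, List.append_nil, List.nil_append, List.map_map,
    Function.comp_def, List.map_cons, List.map_nil, shuffles_singleton, List.sum_singleton,
    List.flatten_cons, List.flatten_nil, splittings, List.length_range',
    show n + 1 - i = j by omega]
  rw [← List.range_eq_range', List.sum_map_range, braceAt]
  refine Finset.sum_congr rfl fun p hp => ?_
  have hp' := Finset.mem_range.1 hp
  have hsplit : (List.range n).take p ++ ((List.range n).drop p).take i ++
      (List.range n).drop (p + i) = List.range n := by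
    rw [← List.drop_drop, List.append_assoc, List.take_append_drop, List.take_append_drop]
  have htake : (List.range n).take p = List.range p := by
    rw [List.take_range, min_eq_left (by omega)]
  -- With one slot the letters stay in order, so the only sign is that of `y` passing the first `p`
  -- letters.
  rw [hsplit, wordSign_of_pairwise_lt _ List.pairwise_lt_range, mul_one, htake]
  congr 1
  congr 1
  funext q
  have hq : (q : ℕ) < j := q.2
  have hy : (fun r : Fin i =>
      (((List.range n).drop p).take i |>.map (entry a)).getD (r : ℕ) 0) =
      fun r : Fin i => entry a (p + r) := by
    funext r
    have hr := r.2
    rw [List.getD_eq_getElem _ _ (by simp; omega)]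
    simp
  rw [List.append_assoc]
  split_ifs with h1 h2
  · rw [List.getD_append _ _ _ _ (by simpa using h1), List.getD_eq_getElem _ _ (by simpa using h1)]
    simp
    rfl
  · rw [List.getD_append_right _ _ _ _ (by simp [h2])]
    simp only [List.length_map, List.length_range, h2, Nat.sub_self, List.cons_append,
      List.getD_cons_zero]
    exact congrArg y hy
  · rw [List.getD_append_right _ _ _ _ (by simp; omega), List.getD_append_right _ _ _ _ (by
      simp; omega), List.getD_eq_getElem _ _ (by simp; omega)]
    simp only [List.getElem_map, List.getElem_drop, List.getElem_range, List.length_map,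
      List.length_range, List.length_singleton]
    congr 1
    omega

variable (𝒜 : ℤ → Submodule k V)

theorem oneSlotPart_single (m : PartitionedMaps k V) (n : ℕ) :
    oneSlotPart m (single n) = m (single n) := if_pos rfl

variable [DirectSum.Decomposition 𝒜]

theorem tildeMap_zero {n : ℕ} : tildeMap 𝒜 (0 : MultiMap k V n) = 0 := rfl

/-- Partitions with at least two slots do not occur in products of one-slot partitions. -/
theorem masterPart_oneSlotPart_of_length_ne_one (m : PartitionedMaps k V) {τ : OrderedPartition}
    (hτ : τ.1.length ≠ 1) : MasterPart 𝒜 (oneSlotPart m) τ := by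
  intro e a _
  refine finsum_eq_zero_of_forall_eq_zero fun q => ?_
  by_contra hne
  have hocc := occurs_of_composeAt_ne_zero _ _ _ _ _ _ hne
  rw [Ne, hocc.length_eq_one_iff, not_and_or] at hτ
  refine hne ?_
  rcases hτ with h | h
  · rw [oneSlotPart, if_neg h, tildeMap_zero, composeAt_zero_left]
  · rw [oneSlotPart, oneSlotPart, if_neg h, tildeMap_zero, composeAt_zero_right]

/-- For one-slot partitions only the one-slot part matters. -/
theorem masterPart_oneSlotPart_single (m : PartitionedMaps k V) (n : ℕ) :
    MasterPart 𝒜 (oneSlotPart m) (single n) ↔ MasterPart 𝒜 m (single n) := by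
  refine forall_congr' fun e => forall_congr' fun a => imp_congr_right fun _ => ?_
  refine Eq.congr_left (finsum_congr fun q => ?_)
  by_cases hocc : Occurs q.1 q.2 (single n)
  · obtain ⟨h1, h2⟩ := hocc.length_eq_one_iff.1 rfl
    rw [oneSlotPart, if_pos h1, oneSlotPart, if_pos h2]
  · rw [not_imp_comm.1 (occurs_of_composeAt_ne_zero _ _ _ _ _ _) hocc,
      not_imp_comm.1 (occurs_of_composeAt_ne_zero _ _ _ _ _ _) hocc]

/-- The part of type `(n)` of the master identity is the `A∞` relation with `n` arguments. -/
theorem masterPart_single_iff (m : PartitionedMaps k V) (h0 : m (single 0) = 0) (n : ℕ) :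
    MasterPart 𝒜 m (single n) ↔ AInftyRelation 𝒜 (oneSlotMap m) n := by
  refine forall_congr' fun e => forall_congr' fun a => imp_congr_right fun _ => ?_
  refine Eq.congr_left ?_
  have hinj : Set.InjOn (fun i => (single (n + 1 - i), single i)) (Finset.Icc 1 n) :=
    fun i _ j _ h => single_injective (congrArg Prod.snd h)
  rw [finsum_eq_finsetSum_of_support_subset (s := (Finset.Icc 1 n).image
    fun i => (single (n + 1 - i), single i)), Finset.sum_image hinj]
  · refine Finset.sum_congr rfl fun i hi => ?_
    have hi' := Finset.mem_Icc.1 hi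
    rw [show (single i).d + (single i).superParity = (i : ℤ) - 1 + i by
      rw [single_d, single_superParity]]
    exact composeAt_single (n := n) (i := i) (j := n + 1 - i) (by omega) (by omega)
      (tildeMap 𝒜 (oneSlotMap m (n + 1 - i)))
      (tildeMap 𝒜 (oneSlotMap m i)) _ e a
  · rintro ⟨π, π'⟩ hq
    obtain ⟨i, hi, rfl, rfl⟩ := (occurs_of_composeAt_ne_zero _ _ _ _ _ _ hq).eq_single
    rw [Finset.coe_image]
    refine ⟨i, ?_, rfl⟩
    rw [Finset.coe_Icc]
    refine ⟨Nat.one_le_iff_ne_zero.2 ?_, hi⟩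
    -- The term `i = 0` would insert `m(0)`, which is zero.
    rintro rfl
    refine hq ?_
    dsimp only
    rw [h0, tildeMap_zero, composeAt_zero_right]

end MasterPart

/-! ### Degrees and antisymmetry of the one-slot maps. -/

section GInftyData

open OrderedPartition

variable {k V : Type*} [Field k] [AddCommGroup V] [Module k V] {𝒜 : ℤ → Submodule k V}
  {m : PartitionedMaps k V}

theorem IsGInftyData.single_zero (hm : IsGInftyData 𝒜 m) : m (single 0) = 0 :=
  hm.irregular _ not_regular_single_zero (single_ne_pair _ _ _) (single_ne_pair _ _ _)

theorem IsGInftyData.isAInftyData (hm : IsGInftyData 𝒜 m) : IsAInftyData 𝒜 (oneSlotMap m) where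
  zero := hm.single_zero
  degree n _ := by
    obtain ⟨s, hs, h⟩ := hm.degree (single n)
    rw [single_superParity] at hs
    exact ⟨s, hs, h⟩

variable [DirectSum.Decomposition 𝒜]

theorem IsGInftyData.isLInftyData (hm : IsGInftyData 𝒜 m) :
    IsLInftyData 𝒜 (fun n => gradedAntisymm 𝒜 (oneSlotMap m n)) where
  zero := by
    ext a
    simp [gradedAntisymm, hm.isAInftyData.zero]
  degree n hn := by
    obtain ⟨s, hs, h⟩ := hm.isAInftyData.degree n hn
    exact ⟨s, hs, gradedAntisymm_hasSuperDegree 𝒜 _ h⟩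
  antisymm n := gradedAntisymm_isGradedAntisymm 𝒜 _

end GInftyData

theorem mainTheorem5 {k V : Type*} [Field k] [CharZero k] [AddCommGroup V] [Module k V]
    (𝒜 : ℤ → Submodule k V) [DirectSum.Decomposition 𝒜] (m : PartitionedMaps k V) :
    (IsGInfty 𝒜 m →
      (∀ τ : OrderedPartition, MasterPart 𝒜 (oneSlotPart m) τ) ∧
      IsAInfty 𝒜 (oneSlotMap m) ∧
      IsLInfty 𝒜 (fun n => gradedAntisymm 𝒜 (oneSlotMap m n))) ∧
    (IsReducedGInfty 𝒜 m →
      (∀ τ : OrderedPartition, oneSlotPart m τ ≠ 0 → MasterPart 𝒜 (oneSlotPart m) τ) ∧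
      IsAInftyData 𝒜 (oneSlotMap m) ∧
      IsLInftyData 𝒜 (fun n => gradedAntisymm 𝒜 (oneSlotMap m n)) ∧
      ∀ n, 1 ≤ n → oneSlotMap m n ≠ 0 →
        AInftyRelation 𝒜 (oneSlotMap m) n ∧
        LInftyRelation 𝒜 (fun n => gradedAntisymm 𝒜 (oneSlotMap m n)) n) := by
  constructor
  · intro hm
    have hd := hm.toIsGInftyData
    have hA : ∀ n, 1 ≤ n → AInftyRelation 𝒜 (oneSlotMap m) n := fun n hn =>
      (masterPart_single_iff 𝒜 m hd.single_zero n).1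
        (hm.master _ (OrderedPartition.regular_single hn))
    refine ⟨fun τ => ?_, ⟨hd.isAInftyData, hA⟩, ⟨hd.isLInftyData, fun n hn =>
      lInftyRelation_gradedAntisymm 𝒜 _ hd.isAInftyData.degree n (hA n hn)⟩⟩
    by_cases hτ : τ.1.length = 1
    · obtain ⟨n, rfl⟩ := OrderedPartition.exists_eq_single hτ
      rw [masterPart_oneSlotPart_single, masterPart_single_iff 𝒜 m hd.single_zero]
      rcases Nat.eq_zero_or_pos n with rfl | hn
      -- Type `(0)` is not regular, so the hypothesis says nothing about it; the corresponding sum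
      -- over `1 ≤ i ≤ 0` is empty.
      · intro e a _
        simp
      · exact hA n hn
    · exact masterPart_oneSlotPart_of_length_ne_one 𝒜 m hτ
  · intro hm
    have hd := hm.toIsGInftyData
    have hM : ∀ n, m (OrderedPartition.single n) ≠ 0 →
        MasterPart 𝒜 m (OrderedPartition.single n) := fun n hn => by
      refine hm.master _ (OrderedPartition.regular_single (Nat.one_le_iff_ne_zero.2 ?_)) hn
      rintro rfl
      exact hn hd.single_zero
    refine ⟨fun τ hne => ?_, hd.isAInftyData, hd.isLInftyData, fun n _ hne => ?_⟩
    · by_cases hτ : τ.1.length = 1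
      · obtain ⟨n, rfl⟩ := OrderedPartition.exists_eq_single hτ
        rw [masterPart_oneSlotPart_single]
        exact hM n (oneSlotPart_single m n ▸ hne)
      · exact masterPart_oneSlotPart_of_length_ne_one 𝒜 m hτ
    · have hA := (masterPart_single_iff 𝒜 m hd.single_zero n).1 (hM n hne)
      exact ⟨hA, lInftyRelation_gradedAntisymm 𝒜 _ hd.isAInftyData.degree n hA⟩
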